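/- **Theorem (uniqueness and global stability).** Let $a\ge b>0$ and $0<n<1$, and put $$f(\varphi)=\frac{(a^2\sin^2\varphi+b^2\cos^2\varphi)^{3/2}}{a^2b^2}.$$ Consider the elliptical pursuit system for real functions $\mu,\zeta$ of $\varphi$, $$\mu'=\frac{e^{-\mu}(\cos\zeta-n)}{f(\varphi)},\qquad \zeta'=-\frac{e^{-\mu}\sin\zeta}{f(\varphi)}+1, \tag{1}$$ and the differential equation $$z'=\frac1{f(\varphi)}-\frac{n}{f(\varphi)}\frac{z}{|z|}+iz,\qquad z(\varphi)\in\mathbb C\setminus\{0\}, \tag{2}$$ which $z=e^{\mu+i\zeta}$ satisfies whenever $(\mu,\zeta)$ satisfies (1). There are functions $\mu^*,\zeta^*:\mathbb R\to\mathbb R$ such that the following hold. 1. $(\mu^*,\zeta^*)$ is a $\pi$-periodic solution of (1) on $\mathbb R$, and it is the only one up to adding a constant integer multiple of $2\pi$ to $\zeta$: every $\pi$-periodic solution of (1) on $\mathbb R$ is $(\mu^*,\zeta^*+2\pi k)$ for some $k\in\mathbb Z$. 2. Every solution $(\mu,\zeta)$ of (1) on a half-line $[\varphi_0,\infty)$ converges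 to it: $\mu(\varphi)-\mu^*(\varphi)\to0$ and, for some $k\in\mathbb Z$, $\zeta(\varphi)-\zeta^*(\varphi)-2\pi k\to0$ as $\varphi\to\infty$. 3. For all $\varphi_0,\mu_0,\zeta_0\in\mathbb R$ there is a solution of (1) with $\mu(\varphi_0)=\mu_0$, $\zeta(\varphi_0)=\zeta_0$ which either is defined on $[\varphi_0,\infty)$ (so that 2 applies), or is defined on $[\varphi_0,\varphi_B)$ for some finite $\varphi_B>\varphi_0$ and ends there by capture, $\mu(\varphi)\to-\infty$ as $\varphi\to\varphi_B-0$. 4. $z^*=e^{\mu^*+i\zeta^*}$ is the unique $\pi$-periodic solution of (2) on $\mathbb R$, and every solution $z$ of (2) on a half-line $[\varphi_0,\infty)$ satisfies $z(\varphi)-z^*(\varphi)\to0$ as $\varphi\to\infty$. -/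

import Mathlib

/-- The angular velocity `dφ/dt` of the direction `φ` of an evader that runs with unit speed,
counterclockwise, around the ellipse with semi-axes `a` and `b`. -/
noncomputable def turningRate (a b φ : ℝ) : ℝ :=
  (a ^ 2 * Real.sin φ ^ 2 + b ^ 2 * Real.cos φ ^ 2) ^ (3 / 2 : ℝ) / (a ^ 2 * b ^ 2)

/-- `(μ, ζ)` solves the elliptical pursuit system on the interval `s`
(one-sided derivatives at end points that belong to `s`). -/
def IsPursuitSolutionOn (a b n : ℝ) (μ ζ : ℝ → ℝ) (s : Set ℝ) : Prop :=
  ∀ φ ∈ s,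
    HasDerivWithinAt μ (Real.exp (-μ φ) * (Real.cos (ζ φ) - n) / turningRate a b φ) s φ ∧
    HasDerivWithinAt ζ (-(Real.exp (-μ φ) * Real.sin (ζ φ)) / turningRate a b φ + 1) s φ

/-- `(μ, ζ)` is a `π`-periodic solution of the elliptical pursuit system. -/
def IsPeriodicPursuitSolution (a b n : ℝ) (μ ζ : ℝ → ℝ) : Prop :=
  IsPursuitSolutionOn a b n μ ζ Set.univ ∧
    Function.Periodic μ Real.pi ∧ Function.Periodic ζ Real.pi

/-- `z` solves `z' = 1 / f - (n / f) z / |z| + i z` on the interval `s`.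
The right-hand side is defined for `z ≠ 0` only, so a solution takes values in `ℂ \ {0}`. -/
def IsComplexPursuitSolutionOn (a b n : ℝ) (z : ℝ → ℂ) (s : Set ℝ) : Prop :=
  ∀ φ ∈ s, z φ ≠ 0 ∧
    HasDerivWithinAt z
      (1 / (turningRate a b φ : ℂ) - (n : ℂ) / (turningRate a b φ : ℂ) * (z φ / (‖z φ‖ : ℂ))
        + Complex.I * z φ) s φ

/-- `z` is a `π`-periodic solution of the complex equation. -/
def IsPeriodicComplexPursuitSolution (a b n : ℝ) (z : ℝ → ℂ) : Prop :=
  IsComplexPursuitSolutionOn a b n z Set.univ ∧ Function.Periodic z Real.pi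

/-- The complex variable `z = e^(μ + i ζ)`. -/
noncomputable def complexState (μ ζ : ℝ → ℝ) (φ : ℝ) : ℂ :=
  Complex.exp ((μ φ : ℂ) + Complex.I * (ζ φ : ℂ))

/-! Up to rotation, `z` is the separation vector between the evader on the ellipse and the pursuer,
so capture means `z = 0`, where the field is singular. Replacing the unit vector `z / |z|` by `z /
max |z| ε` gives a globally Lipschitz field and global solutions; such a solution solves the
original equation as long as it stays at distance at least `ε` from the origin.

A priori bounds come from the ellipse. The truncated pursuer still heads for a point of a convex
curve, so it never leaves the ellipse: the depth `D` satisfies `D' = κ (Q - D)` with `κ, Q ≥ 0`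
(`IsTruncatedSolution.ellipseDepth_nonneg`). Inside the ellipse, capture is excluded uniformly in
`ε` (`exists_lt_norm_of_ellipseDepth_nonneg`): near capture the pursuer trails behind a faster
evader, and then its depth is at least of order the square root of the time left, whereas the depth
is at most proportional to the distance. Hence a truncated pursuit from the centre eventually has
`|z|` bounded above and below and `Im z` bounded below.

Stability comes from dissipation. The terms `1 / f` and `i z` do not affect the distance of two
solutions, while the unit vector term is monotone, so the distance never grows. It is stationary
when the two states are parallel. A small multiple of the product of the radial and transversal
components of the difference, added to the squared distance, repairs this when one state stays in
`Im ≥ y₀ > 0`, and gives exponential decay (`exists_exponential_decay`).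

Comparing the bounded pursuit with its shift by `π` makes its values at multiples of `π` a Cauchy
sequence; the solution through the limit is periodic and lies in the upper half-plane. It attracts
every solution, and a periodic function tending to zero vanishes, which gives uniqueness. Results
for `(μ, ζ)` follow through the logarithm. Existence up to capture uses a separate truncation of
`e^(-μ)`. -/

open Set Filter Topology

/-! ### Global integral curves -/

/-- A bounded vector field that is continuous in time and uniformly Lipschitz in space has a
global integral curve through every point. -/
theorem exists_global_solution {E : Type*} [NormedAddCommGroup E] [NormedSpace ℝ E]
    [CompleteSpace E] {F : ℝ → E → E} {K L : NNReal} (hK : ∀ t, LipschitzWith K (F t))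
    (hc : ∀ x, Continuous fun t => F t x) (hL : ∀ t x, ‖F t x‖ ≤ L) (t₀ : ℝ) (x₀ : E) :
    ∃ x : ℝ → E, x t₀ = x₀ ∧ ∀ t, HasDerivAt x (F t (x t)) t := by
  have key : ∀ N : ℕ, ∃ x : ℝ → E, x t₀ = x₀ ∧ ∀ t ∈ Icc (t₀ - (N + 1)) (t₀ + (N + 1)),
      HasDerivWithinAt x (F t (x t)) (Icc (t₀ - (N + 1)) (t₀ + (N + 1))) t := by
    intro N
    have h0 : t₀ ∈ Icc (t₀ - ((N : ℝ) + 1)) (t₀ + (N + 1)) := by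
      constructor <;> linarith [Nat.cast_nonneg (α := ℝ) N]
    -- Since the field is bounded by `L`, a ball of radius `L (N + 1)` cannot be left within time `N
    -- + 1`, so Picard–Lindelöf covers the whole interval.
    have hP : IsPicardLindelof F (⟨t₀, h0⟩ : Icc (t₀ - ((N : ℝ) + 1)) (t₀ + (N + 1))) x₀
        (L * (N + 1)) 0 L K :=
      { lipschitzOnWith := fun t _ => (hK t).lipschitzOnWith
        continuousOn := fun x _ => (hc x).continuousOn
        norm_le := fun t _ x _ => hL t x
        mul_max_le := by simp }
    exact hP.exists_eq_forall_mem_Icc_hasDerivWithinAt₀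
  choose X hX0 hX using key
  have hX' : ∀ N : ℕ, ∀ t ∈ Ioo (t₀ - ((N : ℝ) + 1)) (t₀ + (N + 1)),
      HasDerivAt (X N) (F t (X N t)) t := fun N t ht =>
    (hX N t (Ioo_subset_Icc_self ht)).hasDerivAt (Icc_mem_nhds ht.1 ht.2)
  have huniq : ∀ M N : ℕ, M ≤ N → EqOn (X M) (X N) (Ioo (t₀ - ((M : ℝ) + 1)) (t₀ + (M + 1))) := by
    intro M N hMN
    have hMN' : (M : ℝ) ≤ N := by exact_mod_cast hMN
    have hM : (0 : ℝ) ≤ M := Nat.cast_nonneg M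
    refine ODE_solution_unique_of_mem_Ioo (v := F) (s := fun _ => univ) (K := K) (t₀ := t₀)
      (fun t _ => (hK t).lipschitzOnWith) ⟨by linarith, by linarith⟩
      (fun t ht => ⟨hX' M t ht, trivial⟩)
      (fun t ht => ⟨hX' N t ⟨by linarith [ht.1], by linarith [ht.2]⟩, trivial⟩)
      (by rw [hX0, hX0])
  refine ⟨fun t => X ⌈|t - t₀|⌉₊ t, hX0 _, fun t => ?_⟩
  set M : ℕ := ⌈|t - t₀|⌉₊ with hMdef
  have hM : |t - t₀| ≤ M := Nat.le_ceil _
  have ht : t ∈ Ioo (t₀ - ((M : ℝ) + 1)) (t₀ + (M + 1)) := by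
    have := abs_le.mp hM
    constructor <;> linarith [this.1, this.2]
  have hnear : (fun s => X ⌈|s - t₀|⌉₊ s) =ᶠ[𝓝 t] X (M + 1) := by
    have h1 : ∀ᶠ s in 𝓝 t, |s - t₀| < M + 1 := by
      have hcont : Continuous fun s : ℝ => |s - t₀| := by fun_prop
      exact hcont.continuousAt.eventually_lt continuousAt_const (by linarith)
    filter_upwards [h1] with s hs
    have hle : ⌈|s - t₀|⌉₊ ≤ M + 1 := by
      apply Nat.ceil_le.mpr
      push_cast
      exact hs.le
    have hs' : |s - t₀| ≤ ⌈|s - t₀|⌉₊ := Nat.le_ceil _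
    refine huniq _ _ hle ?_
    have := abs_le.mp hs'
    constructor <;> linarith [this.1, this.2]
  have hval : X M t = X (M + 1) t := huniq M (M + 1) (Nat.le_succ M) ht
  have hd := hX' (M + 1) t (by
    push_cast
    exact ⟨by linarith [ht.1], by linarith [ht.2]⟩)
  have hd2 := hd.congr_of_eventuallyEq hnear
  show HasDerivAt _ (F t (X M t)) t
  rw [hval]
  exact hd2

/-! ### Geometry of the ellipse -/

/-- The support function of the ellipse with semi-axes `b` and `a`. -/
noncomputable def supportFun (a b φ : ℝ) : ℝ :=
  Real.sqrt (a ^ 2 * Real.sin φ ^ 2 + b ^ 2 * Real.cos φ ^ 2)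

section Ellipse
variable {a b : ℝ}

theorem supportFun_sq (a b φ : ℝ) :
    supportFun a b φ ^ 2 = a ^ 2 * Real.sin φ ^ 2 + b ^ 2 * Real.cos φ ^ 2 :=
  Real.sq_sqrt (by positivity)

theorem le_supportFun (hb : 0 < b) (hab : b ≤ a) (φ : ℝ) : b ≤ supportFun a b φ := by
  apply Real.le_sqrt_of_sq_le
  have h := Real.sin_sq_add_cos_sq φ
  nlinarith [sq_nonneg (Real.sin φ), mul_nonneg (sub_nonneg.2 (pow_le_pow_left₀ hb.le hab 2))
    (sq_nonneg (Real.sin φ))]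

theorem supportFun_le (hb : 0 < b) (hab : b ≤ a) (φ : ℝ) : supportFun a b φ ≤ a := by
  apply Real.sqrt_le_iff.mpr ⟨by linarith, ?_⟩
  have h := Real.sin_sq_add_cos_sq φ
  nlinarith [sq_nonneg (Real.sin φ), mul_nonneg (sub_nonneg.2 (pow_le_pow_left₀ hb.le hab 2))
    (sq_nonneg (Real.cos φ))]

theorem supportFun_pos (hb : 0 < b) (hab : b ≤ a) (φ : ℝ) : 0 < supportFun a b φ :=
  hb.trans_le (le_supportFun hb hab φ)

theorem turningRate_eq (a b φ : ℝ) :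
    turningRate a b φ = supportFun a b φ ^ 3 / (a ^ 2 * b ^ 2) := by
  unfold turningRate supportFun
  congr 1
  rw [Real.sqrt_eq_rpow, ← Real.rpow_mul_natCast (by positivity)]
  norm_num

theorem turningRate_inv (a b φ : ℝ) :
    (turningRate a b φ)⁻¹ = a ^ 2 * b ^ 2 / supportFun a b φ ^ 3 := by
  rw [turningRate_eq, inv_div]

theorem turningRate_pos (hb : 0 < b) (hab : b ≤ a) (φ : ℝ) : 0 < turningRate a b φ := by
  have := supportFun_pos hb hab φ
  have : 0 < a := by linarith
  rw [turningRate_eq]; positivity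

theorem le_turningRate_inv (hb : 0 < b) (hab : b ≤ a) (φ : ℝ) :
    b ^ 2 / a ≤ (turningRate a b φ)⁻¹ := by
  have h1 := supportFun_pos hb hab φ
  have h2 := supportFun_le hb hab φ
  have ha : 0 < a := by linarith
  rw [turningRate_inv, div_le_div_iff₀ ha (by positivity)]
  have := pow_le_pow_left₀ h1.le h2 3
  nlinarith [mul_le_mul_of_nonneg_left this (sq_nonneg b)]

theorem turningRate_inv_le (hb : 0 < b) (hab : b ≤ a) (φ : ℝ) :
    (turningRate a b φ)⁻¹ ≤ a ^ 2 / b := by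
  have h1 := supportFun_pos hb hab φ
  have h2 := le_supportFun hb hab φ
  have ha : 0 < a := by linarith
  rw [turningRate_inv, div_le_div_iff₀ (by positivity) hb]
  have := pow_le_pow_left₀ hb.le h2 3
  nlinarith [mul_le_mul_of_nonneg_left this (sq_nonneg a)]

theorem continuous_supportFun (a b : ℝ) : Continuous (supportFun a b) := by
  unfold supportFun; fun_prop

theorem continuous_turningRate_inv (hb : 0 < b) (hab : b ≤ a) :
    Continuous fun φ => (turningRate a b φ)⁻¹ := by
  simp_rw [turningRate_inv]
  exact continuous_const.div ((continuous_supportFun a b).pow 3)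
    fun φ => (pow_pos (supportFun_pos hb hab φ) 3).ne'

theorem turningRate_add_pi (a b φ : ℝ) : turningRate a b (φ + Real.pi) = turningRate a b φ := by
  simp [turningRate, Real.sin_add_pi, Real.cos_add_pi]

theorem hasDerivAt_supportFun (hb : 0 < b) (hab : b ≤ a) (φ : ℝ) :
    HasDerivAt (supportFun a b)
      ((a ^ 2 - b ^ 2) * Real.sin φ * Real.cos φ / supportFun a b φ) φ := by
  have hpos : 0 < a ^ 2 * Real.sin φ ^ 2 + b ^ 2 * Real.cos φ ^ 2 := by
    rw [← supportFun_sq]; exact pow_pos (supportFun_pos hb hab φ) 2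
  have h := (((Real.hasDerivAt_sin φ).pow 2).const_mul (a ^ 2)).add
    (((Real.hasDerivAt_cos φ).pow 2).const_mul (b ^ 2))
  have h2 := h.sqrt hpos.ne'
  refine h2.congr_deriv ?_
  show _ / (2 * supportFun a b φ) = _
  have := (supportFun_pos hb hab φ).ne'
  field_simp
  push_cast
  ring

end Ellipse

/-! ### A monotonicity criterion and the truncated complex equation -/

theorem le_of_hasDerivAt_nonneg {f f' : ℝ → ℝ} {u v : ℝ} (huv : u ≤ v)
    (hf : ∀ t ∈ Icc u v, HasDerivAt f (f' t) t) (h0 : ∀ t ∈ Icc u v, 0 ≤ f' t) : f u ≤ f v := by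
  have : MonotoneOn f (Icc u v) := by
    apply monotoneOn_of_deriv_nonneg (convex_Icc u v)
    · exact fun t ht => (hf t ht).continuousAt.continuousWithinAt
    · exact fun t ht => (hf t (interior_subset ht)).differentiableAt.differentiableWithinAt
    · intro t ht
      rw [(hf t (interior_subset ht)).deriv]
      exact h0 t (interior_subset ht)
  exact this (left_mem_Icc.2 huv) (right_mem_Icc.2 huv) huv

/-- The truncation `z / max |z| ε` of the unit vector `z / |z|`. -/
noncomputable def cutoffUnit (ε : ℝ) (z : ℂ) : ℂ := (max ‖z‖ ε)⁻¹ • z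

theorem norm_cutoffUnit_le {ε : ℝ} (hε : 0 < ε) (z : ℂ) : ‖cutoffUnit ε z‖ ≤ 1 := by
  have hm : 0 < max ‖z‖ ε := lt_max_of_lt_right hε
  rw [cutoffUnit, norm_smul, norm_inv, Real.norm_of_nonneg hm.le, inv_mul_le_iff₀ hm, mul_one]
  exact le_max_left _ _

theorem norm_cutoffUnit_sub_le {ε : ℝ} (hε : 0 < ε) (z w : ℂ) :
    ‖cutoffUnit ε z - cutoffUnit ε w‖ ≤ 2 / ε * ‖z - w‖ := by
  set m := max ‖z‖ ε with hm
  set k := max ‖w‖ ε with hk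
  have hm0 : ε ≤ m := le_max_right _ _
  have hk0 : ‖w‖ ≤ k := le_max_left _ _
  have hk1 : ε ≤ k := le_max_right _ _
  have hm' : 0 < m := by linarith
  have hk' : 0 < k := by linarith
  have hmk : |k - m| ≤ ‖z - w‖ := by
    calc |k - m| ≤ |‖w‖ - ‖z‖| := by
          have := abs_max_sub_max_le_abs ‖w‖ ‖z‖ ε
          simpa [hm, hk] using this
      _ ≤ ‖w - z‖ := abs_norm_sub_norm_le _ _
      _ = ‖z - w‖ := norm_sub_rev _ _
  -- Splitting off the change of the denominator puts `w` over `m * k`, and `‖w‖ ≤ k` cancels `k`;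
  -- each of the two parts costs `1 / ε`.
  have heq : cutoffUnit ε z - cutoffUnit ε w = m⁻¹ • (z - w) + ((k - m) / (m * k)) • w := by
    have : (k - m) / (m * k) = m⁻¹ - k⁻¹ := by field_simp
    rw [this, sub_smul, smul_sub, cutoffUnit, cutoffUnit]
    abel
  rw [heq]
  have h1 : ‖m⁻¹ • (z - w)‖ ≤ 1 / ε * ‖z - w‖ := by
    rw [norm_smul, norm_inv, Real.norm_of_nonneg hm'.le, ← one_div]
    gcongr
  have h2 : ‖((k - m) / (m * k)) • w‖ ≤ 1 / ε * ‖z - w‖ := by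
    rw [norm_smul, norm_div, Real.norm_of_nonneg (mul_pos hm' hk').le, Real.norm_eq_abs]
    calc |k - m| / (m * k) * ‖w‖ ≤ ‖z - w‖ / (m * k) * k := by gcongr
      _ = 1 / m * ‖z - w‖ := by field_simp
      _ ≤ 1 / ε * ‖z - w‖ := by gcongr
  calc _ ≤ _ := norm_add_le _ _
    _ ≤ 1 / ε * ‖z - w‖ + 1 / ε * ‖z - w‖ := add_le_add h1 h2
    _ = _ := by ring

/-- The complex pursuit field with the unit vector truncated near the origin. -/
noncomputable def truncatedField (a b n ε φ : ℝ) (z : ℂ) : ℂ :=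
  ((turningRate a b φ)⁻¹ : ℝ) - (n * (turningRate a b φ)⁻¹) • cutoffUnit ε z + Complex.I * z

/-- Global solutions of the truncated complex pursuit equation. -/
def IsTruncatedSolution (a b n ε : ℝ) (z : ℝ → ℂ) : Prop :=
  ∀ φ, HasDerivAt z (truncatedField a b n ε φ (z φ)) φ

/-- The rate at which the truncated pursuit shortens the position vector. -/
noncomputable def pursuitRate (a b n ε φ : ℝ) (z : ℂ) : ℝ :=
  n * (turningRate a b φ)⁻¹ / max ‖z‖ ε

theorem hasDerivAt_exp_neg_mul_I (φ : ℝ) :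
    HasDerivAt (fun t : ℝ => Complex.exp (-t * Complex.I))
      (-Complex.I * Complex.exp (-φ * Complex.I)) φ := by
  have h : HasDerivAt (fun z : ℂ => Complex.exp (-z * Complex.I))
      (Complex.exp (-φ * Complex.I) * (-1 * Complex.I)) (φ : ℂ) :=
    (((hasDerivAt_id (φ : ℂ)).neg).mul_const Complex.I).cexp
  exact h.comp_ofReal.congr_deriv (by ring)

theorem norm_exp_neg_mul_I (φ : ℝ) : ‖Complex.exp (-φ * Complex.I)‖ = 1 := by
  have := Complex.norm_exp_ofReal_mul_I (-φ)
  simpa using this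

theorem cutoffUnit_mul {ε : ℝ} {u z : ℂ} (hu : ‖u‖ = 1) :
    cutoffUnit ε (u * z) = u * cutoffUnit ε z := by
  simp [cutoffUnit, hu]
  ring

section
variable {a b n : ℝ}

theorem lipschitzWith_truncatedField (hb : 0 < b) (hab : b ≤ a) (hn0 : 0 < n) {ε : ℝ}
    (hε : 0 < ε) : ∃ K : NNReal, ∀ φ, LipschitzWith K (truncatedField a b n ε φ) := by
  have ha : 0 < a := by linarith
  refine ⟨(n * (a ^ 2 / b) * (2 / ε) + 1).toNNReal, fun φ => ?_⟩
  apply LipschitzWith.of_dist_le_mul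
  intro z w
  have hg := turningRate_inv_le hb hab φ
  have hg0 := inv_pos.2 (turningRate_pos hb hab φ)
  rw [dist_eq_norm, dist_eq_norm]
  have : truncatedField a b n ε φ z - truncatedField a b n ε φ w =
      -((n * (turningRate a b φ)⁻¹) • (cutoffUnit ε z - cutoffUnit ε w)) +
        Complex.I * (z - w) := by
    simp only [truncatedField, smul_sub]; ring
  rw [this]
  calc _ ≤ _ := norm_add_le _ _
    _ = n * (turningRate a b φ)⁻¹ * ‖cutoffUnit ε z - cutoffUnit ε w‖ + ‖z - w‖ := by
        rw [norm_neg, norm_smul, Real.norm_of_nonneg (by positivity)]; simp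
    _ ≤ n * (a ^ 2 / b) * (2 / ε * ‖z - w‖) + ‖z - w‖ := by
        gcongr; exact norm_cutoffUnit_sub_le hε z w
    _ = _ := by rw [Real.coe_toNNReal _ (by positivity)]; ring

/-- The term `i z` makes the field unbounded. The substitution `w = e^(-iφ) z` removes it, and the
cutoff commutes with rotations, so the field for `w` is bounded and Lipschitz. -/
theorem exists_truncatedSolution (hb : 0 < b) (hab : b ≤ a) (hn0 : 0 < n) {ε : ℝ} (hε : 0 < ε)
    (φ₀ : ℝ) (z₀ : ℂ) : ∃ z : ℝ → ℂ, z φ₀ = z₀ ∧ IsTruncatedSolution a b n ε z := by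
  have ha : 0 < a := by linarith
  let F : ℝ → ℂ → ℂ := fun φ w => Complex.exp (-φ * Complex.I) * ((turningRate a b φ)⁻¹ : ℝ) -
    (n * (turningRate a b φ)⁻¹) • cutoffUnit ε w
  have hgc := continuous_turningRate_inv hb hab
  obtain ⟨w, hw0, hw⟩ := exists_global_solution (F := F)
    (K := (n * (a ^ 2 / b) * (2 / ε)).toNNReal)
    (L := (a ^ 2 / b + n * (a ^ 2 / b)).toNNReal) (by
      intro φ
      apply LipschitzWith.of_dist_le_mul
      intro z w
      have hg := turningRate_inv_le hb hab φ
      have hg0 := inv_pos.2 (turningRate_pos hb hab φ)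
      rw [dist_eq_norm, dist_eq_norm]
      have : F φ z - F φ w =
          -((n * (turningRate a b φ)⁻¹) • (cutoffUnit ε z - cutoffUnit ε w)) := by
        simp only [F, smul_sub]; ring
      rw [this, norm_neg, norm_smul, Real.norm_of_nonneg (by positivity)]
      calc _ ≤ n * (a ^ 2 / b) * (2 / ε * ‖z - w‖) := by
            gcongr; exact norm_cutoffUnit_sub_le hε z w
        _ = _ := by rw [Real.coe_toNNReal _ (by positivity)]; ring) (by
      intro w
      have h1 : Continuous fun φ : ℝ => Complex.exp (-φ * Complex.I) := by fun_prop
      exact (h1.mul (Complex.continuous_ofReal.comp hgc)).sub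
        ((continuous_const.mul hgc).smul continuous_const)) (by
      intro φ w
      have hg := turningRate_inv_le hb hab φ
      have hg0 := inv_pos.2 (turningRate_pos hb hab φ)
      calc _ ≤ _ := norm_sub_le _ _
        _ = (turningRate a b φ)⁻¹ + n * (turningRate a b φ)⁻¹ * ‖cutoffUnit ε w‖ := by
            rw [norm_mul, norm_exp_neg_mul_I, norm_smul, Complex.norm_real,
              Real.norm_of_nonneg hg0.le, Real.norm_of_nonneg (by positivity), one_mul]
        _ ≤ a ^ 2 / b + n * (a ^ 2 / b) * 1 := by
            gcongr; exact norm_cutoffUnit_le hε w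
        _ = _ := by rw [Real.coe_toNNReal _ (by positivity)]; ring) φ₀ (Complex.exp (-φ₀ * Complex.I) * z₀)
  have hinv : ∀ φ : ℝ, Complex.exp (φ * Complex.I) * Complex.exp (-φ * Complex.I) = 1 := by
    intro φ; rw [← Complex.exp_add]; simp
  have hnorm : ∀ φ : ℝ, ‖Complex.exp (φ * Complex.I)‖ = 1 := Complex.norm_exp_ofReal_mul_I
  refine ⟨fun φ => Complex.exp (φ * Complex.I) * w φ, ?_, fun φ => ?_⟩
  · simp only [hw0]
    rw [← mul_assoc, hinv, one_mul]
  · have he : HasDerivAt (fun t : ℝ => Complex.exp (t * Complex.I))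
        (Complex.I * Complex.exp (φ * Complex.I)) φ := by
      have h : HasDerivAt (fun z : ℂ => Complex.exp (z * Complex.I))
          (Complex.exp (φ * Complex.I) * (1 * Complex.I)) (φ : ℂ) :=
        ((hasDerivAt_id (φ : ℂ)).mul_const Complex.I).cexp
      exact h.comp_ofReal.congr_deriv (by ring)
    refine (he.mul (hw φ)).congr_deriv ?_
    simp only [F, truncatedField, cutoffUnit_mul (hnorm φ), Complex.real_smul]
    linear_combination (((turningRate a b φ)⁻¹ : ℝ) : ℂ) * hinv φ

theorem IsTruncatedSolution.continuous {ε : ℝ} {z : ℝ → ℂ} (hz : IsTruncatedSolution a b n ε z) :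
    Continuous z := continuous_iff_continuousAt.2 fun φ => (hz φ).continuousAt

theorem IsTruncatedSolution.eq_of_eq (hb : 0 < b) (hab : b ≤ a) (hn0 : 0 < n) {ε : ℝ}
    (hε : 0 < ε) {z w : ℝ → ℂ} (hz : IsTruncatedSolution a b n ε z)
    (hw : IsTruncatedSolution a b n ε w) {φ₀ : ℝ} (h : z φ₀ = w φ₀) : z = w := by
  obtain ⟨K, hK⟩ := lipschitzWith_truncatedField hb hab hn0 hε
  exact ODE_solution_unique_univ (s := fun _ => univ) (fun φ => (hK φ).lipschitzOnWith)
    (fun φ => ⟨hz φ, trivial⟩) (fun φ => ⟨hw φ, trivial⟩) h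

theorem IsTruncatedSolution.comp_add {ε : ℝ} {z : ℝ → ℂ} (hz : IsTruncatedSolution a b n ε z)
    (k : ℕ) : IsTruncatedSolution a b n ε fun φ => z (φ + k * Real.pi) := by
  have hper : ∀ φ, turningRate a b (φ + k * Real.pi) = turningRate a b φ := fun φ =>
    (show Function.Periodic (turningRate a b) Real.pi from turningRate_add_pi a b).nat_mul k φ
  intro φ
  have := (hz (φ + k * Real.pi)).comp_add_const φ (k * Real.pi)
  simpa only [truncatedField, hper] using this

theorem hasDerivAt_re {z : ℝ → ℂ} {z' : ℂ} {φ : ℝ} (h : HasDerivAt z z' φ) :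
    HasDerivAt (fun t => (z t).re) z'.re φ :=
  (Complex.reCLM.hasFDerivAt.comp_hasDerivAt φ h)

theorem hasDerivAt_im {z : ℝ → ℂ} {z' : ℂ} {φ : ℝ} (h : HasDerivAt z z' φ) :
    HasDerivAt (fun t => (z t).im) z'.im φ :=
  (Complex.imCLM.hasFDerivAt.comp_hasDerivAt φ h)

theorem IsTruncatedSolution.hasDerivAt_re {ε : ℝ} {z : ℝ → ℂ}
    (hz : IsTruncatedSolution a b n ε z) (φ : ℝ) :
    HasDerivAt (fun t => (z t).re) ((turningRate a b φ)⁻¹ -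
      pursuitRate a b n ε φ (z φ) * (z φ).re - (z φ).im) φ := by
  refine (_root_.hasDerivAt_re (hz φ)).congr_deriv ?_
  simp [truncatedField, cutoffUnit, pursuitRate, -Complex.ofReal_inv]
  ring

theorem IsTruncatedSolution.hasDerivAt_im {ε : ℝ} {z : ℝ → ℂ}
    (hz : IsTruncatedSolution a b n ε z) (φ : ℝ) :
    HasDerivAt (fun t => (z t).im) ((z φ).re -
      pursuitRate a b n ε φ (z φ) * (z φ).im) φ := by
  refine (_root_.hasDerivAt_im (hz φ)).congr_deriv ?_
  simp [truncatedField, cutoffUnit, pursuitRate, -Complex.ofReal_inv]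
  ring

/-! ### Depth inside the ellipse -/

/-- The square of the elliptic norm of the position vector `e^(-iφ) z`. -/
noncomputable def ellipticSq (a b φ : ℝ) (z : ℂ) : ℝ :=
  ((z.re * Real.cos φ + z.im * Real.sin φ) / a) ^ 2 +
    ((z.im * Real.cos φ - z.re * Real.sin φ) / b) ^ 2

/-- `1 - (X² / b² + Y² / a²)` at the position `(X, Y)` of the pursuer: positive inside the ellipse
on which the evader runs. -/
noncomputable def ellipseDepth (a b φ : ℝ) (z : ℂ) : ℝ :=
  2 * z.im / supportFun a b φ - ellipticSq a b φ z

/-- The pursuer `P` has velocity `κ p`, with `p` the separation from the evader `E = P + p`, and `D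
= 1 - N(P)²` for the elliptic norm `N`. Expanding with `N(E) = 1` gives `D = 2⟨E, p⟩ - Q` and `D' =
-2κ⟨E - p, p⟩ = κ (Q - D)`. The motion of the evader drops out. -/
theorem IsTruncatedSolution.hasDerivAt_ellipseDepth (hb : 0 < b) (hab : b ≤ a) {ε : ℝ}
    {z : ℝ → ℂ} (hz : IsTruncatedSolution a b n ε z) (φ : ℝ) :
    HasDerivAt (fun t => ellipseDepth a b t (z t)) (pursuitRate a b n ε φ (z φ) *
      (ellipticSq a b φ (z φ) - ellipseDepth a b φ (z φ))) φ := by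
  have hx := hz.hasDerivAt_re φ
  have hy := hz.hasDerivAt_im φ
  have hs := Real.hasDerivAt_sin φ
  have hc := Real.hasDerivAt_cos φ
  have hh := hasDerivAt_supportFun hb hab φ
  have hpos := supportFun_pos hb hab φ
  have h1 := (hy.const_mul 2).div hh hpos.ne'
  have h2 := ((((hx.mul hc).add (hy.mul hs)).div_const a).pow 2)
  have h3 := ((((hy.mul hc).sub (hx.mul hs)).div_const b).pow 2)
  refine (h1.sub (h2.add h3)).congr_deriv ?_
  simp only [ellipseDepth, ellipticSq, turningRate_inv, Pi.add_apply, Pi.mul_apply, Pi.sub_apply]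
  have hsq := supportFun_sq a b φ
  have ha : a ≠ 0 := by linarith
  have hb' : b ≠ 0 := hb.ne'
  set κ := pursuitRate a b n ε φ (z φ)
  set h := supportFun a b φ
  set x := (z φ).re
  set y := (z φ).im
  set s := Real.sin φ
  set c := Real.cos φ
  linear_combination (norm := (push_cast; field_simp; ring)) (2 * x / h ^ 3) * hsq

theorem sq_norm_le_ellipticSq (hb : 0 < b) (hab : b ≤ a) (φ : ℝ) (z : ℂ) :
    ‖z‖ ^ 2 / a ^ 2 ≤ ellipticSq a b φ z := by
  have ha : 0 < a := by linarith
  have h1 : ‖z‖ ^ 2 = (z.re * Real.cos φ + z.im * Real.sin φ) ^ 2 +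
      (z.im * Real.cos φ - z.re * Real.sin φ) ^ 2 := by
    rw [← Complex.normSq_eq_norm_sq, Complex.normSq_apply]
    linear_combination -(z.re ^ 2 + z.im ^ 2) * Real.sin_sq_add_cos_sq φ
  rw [h1, ellipticSq, add_div, div_pow, div_pow]
  have : b ^ 2 ≤ a ^ 2 := pow_le_pow_left₀ hb.le hab 2
  gcongr

theorem ellipticSq_nonneg (a b φ : ℝ) (z : ℂ) : 0 ≤ ellipticSq a b φ z := by
  unfold ellipticSq; positivity

theorem im_nonneg_of_ellipseDepth_nonneg (hb : 0 < b) (hab : b ≤ a) {φ : ℝ} {z : ℂ}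
    (h : 0 ≤ ellipseDepth a b φ z) : 0 ≤ z.im := by
  have h1 := supportFun_pos hb hab φ
  have h2 := ellipticSq_nonneg a b φ z
  have h3 : 0 ≤ 2 * z.im / supportFun a b φ := by unfold ellipseDepth at h; linarith
  have h4 := mul_nonneg h3 h1.le
  rw [div_mul_cancel₀ _ h1.ne'] at h4
  linarith

/-- Used in two ways: near capture the depth is at most linear in the distance, and a lower bound
for the depth keeps the state away from the real axis. -/
theorem mul_ellipseDepth_le (hb : 0 < b) (hab : b ≤ a) {φ : ℝ} {z : ℂ}
    (h : 0 ≤ ellipseDepth a b φ z) : b * ellipseDepth a b φ z ≤ 2 * z.im := by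
  have h1 := supportFun_pos hb hab φ
  have h2 := ellipticSq_nonneg a b φ z
  have h3 : ellipseDepth a b φ z ≤ 2 * z.im / supportFun a b φ := by unfold ellipseDepth; linarith
  calc b * ellipseDepth a b φ z ≤ supportFun a b φ * (2 * z.im / supportFun a b φ) :=
        mul_le_mul (le_supportFun hb hab φ) h3 h h1.le
    _ = 2 * z.im := by field_simp

/-- The depth is a linear term minus a positive definite quadratic form. -/
theorem norm_le_of_ellipseDepth_nonneg (hb : 0 < b) (hab : b ≤ a) {φ : ℝ} {z : ℂ}
    (h : 0 ≤ ellipseDepth a b φ z) : ‖z‖ ≤ 2 * a ^ 2 / b := by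
  have ha : 0 < a := by linarith
  have h1 := sq_norm_le_ellipticSq hb hab φ z
  have hs := supportFun_pos hb hab φ
  have hi := im_nonneg_of_ellipseDepth_nonneg hb hab h
  have h2 : 2 * z.im / supportFun a b φ ≤ 2 * ‖z‖ / b := by
    have := (le_abs_self _).trans (Complex.abs_im_le_norm z)
    have := le_supportFun hb hab φ
    gcongr
  have h3 : ‖z‖ ^ 2 / a ^ 2 ≤ 2 * ‖z‖ / b := by unfold ellipseDepth at h; linarith
  rw [div_le_div_iff₀ (by positivity) hb] at h3
  rw [le_div_iff₀ hb]
  rcases (norm_nonneg z).eq_or_lt with h0 | h0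
  · rw [← h0, zero_mul]; positivity
  · nlinarith

/-- In the rotated frame the separation vector changes at rate at most `(1 + n) / f`, which is below
`2 / f`. -/
theorem IsTruncatedSolution.norm_le_norm_add (hb : 0 < b) (hab : b ≤ a) (hn0 : 0 < n)
    (hn1 : n < 1) {ε : ℝ} (hε : 0 < ε) {z : ℝ → ℂ} (hz : IsTruncatedSolution a b n ε z)
    (φ ψ : ℝ) : ‖z φ‖ ≤ ‖z ψ‖ + 2 * (a ^ 2 / b) * |φ - ψ| := by
  have hd : ∀ t : ℝ, HasDerivAt (fun t : ℝ => Complex.exp (-t * Complex.I) * z t)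
      (Complex.exp (-t * Complex.I) * (((turningRate a b t)⁻¹ : ℝ) -
        (n * (turningRate a b t)⁻¹) • cutoffUnit ε (z t))) t := fun t =>
    ((hasDerivAt_exp_neg_mul_I t).mul (hz t)).congr_deriv (by
      simp only [truncatedField]; ring)
  have hbd : ∀ t : ℝ, ‖Complex.exp (-t * Complex.I) * (((turningRate a b t)⁻¹ : ℝ) -
        (n * (turningRate a b t)⁻¹) • cutoffUnit ε (z t))‖ ≤ 2 * (a ^ 2 / b) := by
    intro t
    have hg := turningRate_inv_le hb hab t
    have hg0 := inv_pos.2 (turningRate_pos hb hab t)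
    rw [norm_mul, norm_exp_neg_mul_I, one_mul]
    refine (norm_sub_le _ _).trans ?_
    rw [norm_smul, Complex.norm_real, Real.norm_of_nonneg hg0.le,
      Real.norm_of_nonneg (by positivity)]
    have h1 := norm_cutoffUnit_le hε (z t)
    have h2 : n * (turningRate a b t)⁻¹ * ‖cutoffUnit ε (z t)‖ ≤ 1 * (turningRate a b t)⁻¹ * 1 := by
      gcongr
    linarith
  have h := convex_univ.norm_image_sub_le_of_norm_hasDerivWithin_le
    (fun t _ => (hd t).hasDerivWithinAt) (fun t _ => hbd t) (mem_univ ψ) (mem_univ φ)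
  have h1 : ∀ t : ℝ, ‖Complex.exp (-t * Complex.I) * z t‖ = ‖z t‖ := fun t => by
    rw [norm_mul, norm_exp_neg_mul_I, one_mul]
  have h2 := norm_le_norm_add_norm_sub' (Complex.exp (-φ * Complex.I) * z φ)
    (Complex.exp (-ψ * Complex.I) * z ψ)
  rw [h1, h1] at h2
  rw [Real.norm_eq_abs] at h
  linarith

end

/-! ### Uniform distance from capture -/

/-- Lower bound for a nonnegative solution of `D' = κ (Q - D)`. -/
theorem exp_mul_le_of_relaxation {D κ Q : ℝ → ℝ} {u v κ₁ κ₂ q : ℝ} (huv : u ≤ v)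
    (hκ₁ : 0 ≤ κ₁) (hq : 0 ≤ q) (hD0 : ∀ t ∈ Icc u v, 0 ≤ D t)
    (hD : ∀ t ∈ Icc u v, HasDerivAt D (κ t * (Q t - D t)) t)
    (hκ : ∀ t ∈ Icc u v, κ₁ ≤ κ t ∧ κ t ≤ κ₂) (hQ : ∀ t ∈ Icc u v, q ≤ Q t) :
    Real.exp (-(κ₂ * (v - u))) * (κ₁ * q * (v - u)) ≤ D v := by
  have hκ₂ : 0 ≤ κ₂ := hκ₁.trans ((hκ u (left_mem_Icc.2 huv)).1.trans (hκ u (left_mem_Icc.2 huv)).2)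
  -- As `D ≥ 0`, the constant integrating factor with the largest rate `κ₂` can replace the exact
  -- one.
  have h := le_of_hasDerivAt_nonneg (f := fun t => D t * Real.exp (κ₂ * (t - u)) - κ₁ * q * (t - u))
    (f' := fun t => κ t * (Q t - D t) * Real.exp (κ₂ * (t - u)) +
      D t * (Real.exp (κ₂ * (t - u)) * κ₂) - κ₁ * q) huv (by
      intro t ht
      have h1 : HasDerivAt (fun t => κ₂ * (t - u)) κ₂ t := by
        simpa using ((hasDerivAt_id t).sub_const u).const_mul κ₂
      have h2 : HasDerivAt (fun t => κ₁ * q * (t - u)) (κ₁ * q) t := by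
        simpa using ((hasDerivAt_id t).sub_const u).const_mul (κ₁ * q)
      exact ((hD t ht).mul h1.exp).sub h2) (by
      intro t ht
      obtain ⟨h1, h2⟩ := hκ t ht
      have h3 := hQ t ht
      have h4 := hD0 t ht
      have h5 : 1 ≤ Real.exp (κ₂ * (t - u)) :=
        Real.one_le_exp (mul_nonneg hκ₂ (sub_nonneg.2 ht.1))
      have h6 : κ₁ * q ≤ κ t * Q t := mul_le_mul h1 h3 hq (hκ₁.trans h1)
      have h7 : 0 ≤ (κ₂ - κ t) * D t := mul_nonneg (sub_nonneg.2 h2) h4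
      have h8 : κ₁ * q ≤ κ t * (Q t - D t) + D t * κ₂ := by linarith
      have h9 : 0 ≤ κ₁ * q := mul_nonneg hκ₁ hq
      nlinarith)
  simp only [sub_self, mul_zero, Real.exp_zero, mul_one, sub_zero] at h
  have hu := hD0 u (left_mem_Icc.2 huv)
  rw [Real.exp_neg, inv_mul_le_iff₀ (Real.exp_pos _)]
  linarith [mul_comm (D v) (Real.exp (κ₂ * (v - u)))]

section
variable {a b n : ℝ}

theorem pursuitRate_nonneg (hb : 0 < b) (hab : b ≤ a) (hn0 : 0 < n) {ε : ℝ} (hε : 0 < ε)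
    (φ : ℝ) (z : ℂ) : 0 ≤ pursuitRate a b n ε φ z := by
  have hg0 := inv_pos.2 (turningRate_pos hb hab φ)
  have hm : 0 < max ‖z‖ ε := lt_max_of_lt_right hε
  unfold pursuitRate; positivity

theorem pursuitRate_mul_norm_le (hb : 0 < b) (hab : b ≤ a) (hn0 : 0 < n) {ε : ℝ} (hε : 0 < ε)
    (φ : ℝ) (z : ℂ) : pursuitRate a b n ε φ z * ‖z‖ ≤ n * (turningRate a b φ)⁻¹ := by
  have hg0 := inv_pos.2 (turningRate_pos hb hab φ)
  have hm : 0 < max ‖z‖ ε := lt_max_of_lt_right hε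
  unfold pursuitRate
  rw [div_mul_eq_mul_div, div_le_iff₀ hm]
  gcongr
  exact le_max_left _ _

theorem pursuitRate_le (hb : 0 < b) (hab : b ≤ a) (hn0 : 0 < n) {ε : ℝ}
    {φ : ℝ} {z : ℂ} {ρ : ℝ} (hρ : 0 < ρ) (hz : ρ ≤ ‖z‖) :
    pursuitRate a b n ε φ z ≤ n * (a ^ 2 / b) / ρ := by
  have hg0 := inv_pos.2 (turningRate_pos hb hab φ)
  have hg := turningRate_inv_le hb hab φ
  have hm : ρ ≤ max ‖z‖ ε := hz.trans (le_max_left _ _)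
  unfold pursuitRate
  have : 0 < a := by linarith
  gcongr

theorem le_pursuitRate (hb : 0 < b) (hab : b ≤ a) (hn0 : 0 < n) {ε : ℝ}
    {φ : ℝ} {z : ℂ} {ρ : ℝ} (hε : 0 < ε) (hερ : ε ≤ ρ) (hz : ‖z‖ ≤ ρ) :
    n * (b ^ 2 / a) / ρ ≤ pursuitRate a b n ε φ z := by
  have hg := le_turningRate_inv hb hab φ
  have hm : max ‖z‖ ε ≤ ρ := max_le hz hερ
  have hm0 : 0 < max ‖z‖ ε := lt_max_of_lt_right hε
  have : 0 < a := by linarith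
  have hg0 := inv_pos.2 (turningRate_pos hb hab φ)
  unfold pursuitRate
  gcongr

/-- With the integrating factor `e^(∫ κ)` the equation `D' = κ (Q - D)` becomes `(D e^(∫ κ))' = κ Q
e^(∫ κ) ≥ 0`. -/
theorem IsTruncatedSolution.ellipseDepth_nonneg (hb : 0 < b) (hab : b ≤ a) (hn0 : 0 < n)
    {ε : ℝ} (hε : 0 < ε) {z : ℝ → ℂ} (hz : IsTruncatedSolution a b n ε z) {φ₀ : ℝ}
    (h0 : 0 ≤ ellipseDepth a b φ₀ (z φ₀)) {φ : ℝ} (hφ : φ₀ ≤ φ) :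
    0 ≤ ellipseDepth a b φ (z φ) := by
  set κ : ℝ → ℝ := fun t => pursuitRate a b n ε t (z t) with hκdef
  have hκc : Continuous κ := by
    have h1 := continuous_turningRate_inv hb hab
    have h2 : Continuous fun t => max ‖z t‖ ε := hz.continuous.norm.max continuous_const
    exact (continuous_const.mul h1).div h2 fun t => (lt_max_of_lt_right hε).ne'
  have hA : ∀ t, HasDerivAt (fun t => ∫ s in φ₀..t, κ s) (κ t) t := fun t =>
    (hκc.integral_hasStrictDerivAt φ₀ t).hasDerivAt
  have h := le_of_hasDerivAt_nonneg
    (f := fun t => ellipseDepth a b t (z t) * Real.exp (∫ s in φ₀..t, κ s)) hφ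
    (fun t _ => (hz.hasDerivAt_ellipseDepth hb hab t).mul (hA t).exp) (by
      intro t _
      have h1 : 0 ≤ κ t * ellipticSq a b t (z t) * Real.exp (∫ s in φ₀..t, κ s) :=
        mul_nonneg (mul_nonneg (pursuitRate_nonneg hb hab hn0 hε t (z t))
          (ellipticSq_nonneg a b t (z t))) (Real.exp_pos _).le
      have h2 : κ t = pursuitRate a b n ε t (z t) := rfl
      rw [← h2]
      linarith)
  simp only [intervalIntegral.integral_same, Real.exp_zero, mul_one] at h
  have h3 := h0.trans h
  exact nonneg_of_mul_nonneg_left h3 (Real.exp_pos _)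

set_option maxHeartbeats 1000000 in
/-- A truncated pursuit that has stayed inside the ellipse for a certain time is uniformly far from
capture. -/
theorem exists_lt_norm_of_ellipseDepth_nonneg (hb : 0 < b) (hab : b ≤ a) (hn0 : 0 < n)
    (hn1 : n < 1) : ∃ δ > 0, ∃ T > 0, ∀ ε, 0 < ε → ε ≤ δ → ∀ z : ℝ → ℂ,
      IsTruncatedSolution a b n ε z → ∀ φ : ℝ,
      (∀ t ∈ Icc (φ - T) φ, 0 ≤ ellipseDepth a b t (z t)) → δ < ‖z φ‖ := by
  have ha : 0 < a := by linarith
  have hn1' : 0 < 1 - n := by linarith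
  obtain ⟨g₀, hg₀⟩ : ∃ g₀, g₀ = b ^ 2 / a := ⟨_, rfl⟩
  obtain ⟨g₁, hg₁⟩ : ∃ g₁, g₁ = a ^ 2 / b := ⟨_, rfl⟩
  have hg₀p : 0 < g₀ := by rw [hg₀]; positivity
  have hg₁p : 0 < g₁ := by rw [hg₁]; positivity
  -- Within distance `r₀` of the origin, `Re z` grows at rate at least `(1 - n) g₀ - r₀ = r₀`.
  obtain ⟨r₀, hr₀⟩ : ∃ r₀, r₀ = (1 - n) * g₀ / 2 := ⟨_, rfl⟩
  have hr₀p : 0 < r₀ := by rw [hr₀]; positivity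
  -- Over time `T` the norm changes by at most `2 g₁ T = r₀ / 2`, so a state that ends within `r₀ /
  -- 2` was within `r₀` throughout.
  obtain ⟨T, hT⟩ : ∃ T, T = r₀ / (4 * g₁) := ⟨_, rfl⟩
  have hTp : 0 < T := by rw [hT]; positivity
  obtain ⟨p₀, hp₀⟩ : ∃ p₀, p₀ = r₀ * T / 4 := ⟨_, rfl⟩
  have hp₀p : 0 < p₀ := by rw [hp₀]; positivity
  obtain ⟨κ₁, hκ₁⟩ : ∃ κ₁, κ₁ = n * g₀ / r₀ := ⟨_, rfl⟩
  have hκ₁p : 0 < κ₁ := by rw [hκ₁]; positivity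
  obtain ⟨κ₂, hκ₂⟩ : ∃ κ₂, κ₂ = n * g₁ / p₀ := ⟨_, rfl⟩
  obtain ⟨d₀, hd₀⟩ : ∃ d₀, d₀ = Real.exp (-(κ₂ * (T / 2))) * (κ₁ * (p₀ ^ 2 / a ^ 2) * (T / 2)) :=
    ⟨_, rfl⟩
  have hd₀p : 0 < d₀ := by rw [hd₀]; positivity
  obtain ⟨C, hC⟩ : ∃ C, C = 2 * n * g₁ / b := ⟨_, rfl⟩
  have hCp : 0 < C := by rw [hC]; positivity
  obtain ⟨B, hB⟩ : ∃ B, B = C + r₀ / b := ⟨_, rfl⟩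
  have hBp : 0 < B := by rw [hB]; positivity
  -- The second entry makes the two bounds `d₀² τ / 2 ≤ D²` and `D ≤ B τ` at time `φ - τ`
  -- incompatible.
  obtain ⟨τ, hτ⟩ : ∃ τ, τ = min (T / 2) (d₀ ^ 2 / (4 * B ^ 2)) := ⟨_, rfl⟩
  have hτp : 0 < τ := by rw [hτ]; positivity
  have hτT : τ ≤ T / 2 := by rw [hτ]; exact min_le_left _ _
  have hτd : 4 * B ^ 2 * τ ≤ d₀ ^ 2 := by
    have : τ ≤ d₀ ^ 2 / (4 * B ^ 2) := by rw [hτ]; exact min_le_right _ _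
    rwa [le_div_iff₀ (by positivity), mul_comm] at this
  obtain ⟨δ, hδ⟩ : ∃ δ, δ = min (r₀ / 2) (r₀ * τ / 2) := ⟨_, rfl⟩
  have hδp : 0 < δ := by rw [hδ]; positivity
  have hδr : δ ≤ r₀ / 2 := by rw [hδ]; exact min_le_left _ _
  have hδτ : δ ≤ r₀ * τ / 2 := by rw [hδ]; exact min_le_right _ _
  refine ⟨δ, hδp, T, hTp, fun ε hε hεδ z hz φ hD => ?_⟩
  by_contra! hcon
  have hgT : 2 * g₁ * T = r₀ / 2 := by rw [hT]; field_simp; ring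
  have hr : ∀ t ∈ Icc (φ - T) φ, ‖z t‖ ≤ r₀ := by
    intro t ht
    have h1 := hz.norm_le_norm_add hb hab hn0 hn1 hε t φ
    have h2 : |t - φ| ≤ T := by rw [abs_le]; constructor <;> linarith [ht.1, ht.2]
    rw [← hg₁] at h1
    nlinarith
  have hg : ∀ t, g₀ ≤ (turningRate a b t)⁻¹ := fun t => hg₀ ▸ le_turningRate_inv hb hab t
  have hg' : ∀ t, (turningRate a b t)⁻¹ ≤ g₁ := fun t => hg₁ ▸ turningRate_inv_le hb hab t
  have hκ0 : ∀ t, 0 ≤ pursuitRate a b n ε t (z t) := fun t =>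
    pursuitRate_nonneg hb hab hn0 hε t (z t)
  have hκr : ∀ t, pursuitRate a b n ε t (z t) * ‖z t‖ ≤ n * (turningRate a b t)⁻¹ := fun t =>
    pursuitRate_mul_norm_le hb hab hn0 hε t (z t)
  have hre : ∀ t, |(z t).re| ≤ ‖z t‖ := fun t => Complex.abs_re_le_norm _
  have him : ∀ t, (z t).im ≤ ‖z t‖ := fun t => (le_abs_self _).trans (Complex.abs_im_le_norm _)
  have hx' : ∀ t ∈ Icc (φ - T) φ,
      r₀ ≤ (turningRate a b t)⁻¹ - pursuitRate a b n ε t (z t) * (z t).re - (z t).im := by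
    intro t ht
    have h1 : pursuitRate a b n ε t (z t) * (z t).re ≤ n * (turningRate a b t)⁻¹ :=
      (mul_le_mul_of_nonneg_left ((le_abs_self _).trans (hre t)) (hκ0 t)).trans (hκr t)
    have h2 := hr t ht
    have h3 := him t
    linarith [mul_le_mul_of_nonneg_left (hg t) hn1'.le]
  have hx : ∀ t ∈ Icc (φ - T) φ, (z t).re ≤ δ - r₀ * (φ - t) := by
    intro t ht
    have h1 := le_of_hasDerivAt_nonneg (f := fun s => (z s).re - r₀ * s) ht.2
      (fun s _ => (hz.hasDerivAt_re s).sub (by simpa using (hasDerivAt_id s).const_mul r₀))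
      (fun s hs => sub_nonneg.2 (hx' s ⟨ht.1.trans hs.1, hs.2⟩))
    have h2 := (le_abs_self _).trans ((hre φ).trans hcon)
    linarith
  have hDd : ∀ t, HasDerivAt (fun t => ellipseDepth a b t (z t)) (pursuitRate a b n ε t (z t) *
      (ellipticSq a b t (z t) - ellipseDepth a b t (z t))) t := hz.hasDerivAt_ellipseDepth hb hab
  -- the depth gained while the pursuer is at a definite distance
  have hD1 : d₀ ≤ ellipseDepth a b (φ - T / 2) (z (φ - T / 2)) := by
    have hsub : ∀ t ∈ Icc (φ - T) (φ - T / 2), t ∈ Icc (φ - T) φ := fun t ht =>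
      ⟨ht.1, by linarith [ht.2]⟩
    have hp : ∀ t ∈ Icc (φ - T) (φ - T / 2), p₀ ≤ ‖z t‖ := by
      intro t ht
      have h1 := hx t (hsub t ht)
      have h2 := (neg_le_abs _).trans (hre t)
      have h3 : r₀ * (T / 2) ≤ r₀ * (φ - t) := by
        apply mul_le_mul_of_nonneg_left _ hr₀p.le; linarith [ht.2]
      have h4 : r₀ * τ ≤ r₀ * (T / 2) := mul_le_mul_of_nonneg_left hτT hr₀p.le
      rw [hp₀]
      linarith
    have h := exp_mul_le_of_relaxation (u := φ - T) (v := φ - T / 2) (κ₁ := κ₁) (κ₂ := κ₂)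
      (q := p₀ ^ 2 / a ^ 2) (by linarith) hκ₁p.le (by positivity)
      (fun t ht => hD t (hsub t ht)) (fun t _ => hDd t) (fun t ht => ⟨?_, ?_⟩) (fun t ht => ?_)
    · have h1 : φ - T / 2 - (φ - T) = T / 2 := by ring
      rw [h1, ← hd₀] at h
      exact h
    · rw [hκ₁, hg₀]
      exact le_pursuitRate hb hab hn0 hε (by linarith) (hr t (hsub t ht))
    · rw [hκ₂, hg₁]
      exact pursuitRate_le hb hab hn0 hp₀p (hp t ht)
    · refine le_trans ?_ (sq_norm_le_ellipticSq hb hab t (z t))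
      have := hp t ht
      gcongr
  -- the loss until shortly before the end
  have hD2 : d₀ ^ 2 * τ / 2 ≤ ellipseDepth a b (φ - τ) (z (φ - τ)) ^ 2 := by
    have hsub : ∀ t ∈ Icc (φ - T / 2) (φ - τ), t ∈ Icc (φ - T) φ := fun t ht =>
      ⟨by linarith [ht.1], by linarith [ht.2]⟩
    have hp : ∀ t ∈ Icc (φ - T / 2) (φ - τ), r₀ * τ / 2 ≤ -(z t).re := by
      intro t ht
      have h1 := hx t (hsub t ht)
      have h3 : r₀ * τ ≤ r₀ * (φ - t) := by
        apply mul_le_mul_of_nonneg_left _ hr₀p.le; linarith [ht.2]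
      linarith
    have hpp : ∀ t ∈ Icc (φ - T / 2) (φ - τ), 0 < -(z t).re := fun t ht =>
      (by positivity : 0 < r₀ * τ / 2).trans_le (hp t ht)
    -- `D² / (-Re z)` is nondecreasing: the numerator of its derivative is `2 κ Q D (-Re z) + D² (g
    -- - Im z + κ Re z)` with `g = 1 / f`, and the last bracket is nonnegative because `κ |z| ≤ n g`
    -- and `Im z ≤ r₀`. So the depth shrinks at worst like the square root of `-Re z`.
    have h := le_of_hasDerivAt_nonneg
      (f := fun t => ellipseDepth a b t (z t) ^ 2 / (-(z t).re)) (u := φ - T / 2) (v := φ - τ)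
      (by linarith)
      (fun t ht => ((hDd t).pow 2).div (hz.hasDerivAt_re t).neg (hpp t ht).ne') (by
        intro t ht
        apply div_nonneg _ (sq_nonneg _)
        have hD0 := hD t (hsub t ht)
        have hQ0 := ellipticSq_nonneg a b t (z t)
        have hk0 := hκ0 t
        have hp0 := hpp t ht
        have h1 : pursuitRate a b n ε t (z t) * (-(z t).re) ≤ n * (turningRate a b t)⁻¹ :=
          (mul_le_mul_of_nonneg_left ((neg_le_abs _).trans (hre t)) (hκ0 t)).trans (hκr t)
        have h2 := hr t (hsub t ht)
        have h3 := him t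
        have h4 := hg t
        have h5 : 0 ≤ (turningRate a b t)⁻¹ - (z t).im +
            pursuitRate a b n ε t (z t) * (z t).re := by
          linarith [mul_le_mul_of_nonneg_left h4 hn1'.le]
        have h6 := mul_nonneg (mul_nonneg (mul_nonneg hk0 hQ0) hD0) hp0.le
        have h7 := mul_nonneg (mul_nonneg hD0 hD0) h5
        refine (add_nonneg (mul_nonneg zero_le_two h6) h7).trans_eq ?_
        push_cast
        simp only [Pi.pow_apply, Pi.neg_apply]
        ring)
    have hl : φ - T / 2 ∈ Icc (φ - T / 2) (φ - τ) := ⟨le_rfl, by linarith⟩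
    have hrr : φ - τ ∈ Icc (φ - T / 2) (φ - τ) := ⟨by linarith, le_rfl⟩
    have h1 := hpp _ hl
    have h2 := hp _ hrr
    have h3 : -(z (φ - T / 2)).re ≤ r₀ := (neg_le_abs _).trans ((hre _).trans (hr _ (hsub _ hl)))
    have h4 : d₀ ^ 2 / r₀ ≤ ellipseDepth a b (φ - T / 2) (z (φ - T / 2)) ^ 2 /
        (-(z (φ - T / 2)).re) := by
      have : d₀ ^ 2 ≤ ellipseDepth a b (φ - T / 2) (z (φ - T / 2)) ^ 2 :=
        pow_le_pow_left₀ hd₀p.le hD1 2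
      gcongr
    have h5 := h4.trans h
    rw [div_le_div_iff₀ hr₀p (hpp _ hrr)] at h5
    have h6 := mul_le_mul_of_nonneg_left h2 (sq_nonneg d₀)
    have h7 : r₀ * (d₀ ^ 2 * τ / 2) ≤ r₀ * ellipseDepth a b (φ - τ) (z (φ - τ)) ^ 2 := by linarith
    exact le_of_mul_le_mul_left h7 hr₀p
  -- the loss at the end
  have hD3 : ellipseDepth a b (φ - τ) (z (φ - τ)) ≤ B * τ := by
    have hsub : ∀ t ∈ Icc (φ - τ) φ, t ∈ Icc (φ - T) φ := fun t ht =>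
      ⟨by linarith [ht.1], ht.2⟩
    have h := le_of_hasDerivAt_nonneg (f := fun t => ellipseDepth a b t (z t) + C * t)
      (u := φ - τ) (v := φ) (by linarith)
      (fun t _ => (hDd t).add (by simpa using (hasDerivAt_id t).const_mul C)) (by
        intro t ht
        have hD0 := hD t (hsub t ht)
        have h1 := mul_nonneg (hκ0 t) (ellipticSq_nonneg a b t (z t))
        have h2 := mul_ellipseDepth_le hb hab hD0
        -- The rate `κ` may be large near the origin, but `D ≤ 2 |z| / b` and `κ |z| ≤ n g₁` keep
        -- the loss rate `κ D` below `C`.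
        have h3 : pursuitRate a b n ε t (z t) * (b * ellipseDepth a b t (z t)) ≤ 2 * (n * g₁) := by
          have h4 := mul_le_mul_of_nonneg_left (h2.trans (mul_le_mul_of_nonneg_left (him t)
            zero_le_two)) (hκ0 t)
          have h5 := hκr t
          have h6 := mul_le_mul_of_nonneg_left (hg' t) hn0.le
          linarith
        have h7 : pursuitRate a b n ε t (z t) * ellipseDepth a b t (z t) ≤ C := by
          rw [hC, le_div_iff₀ hb]; linarith
        linarith)
    have h1 := mul_ellipseDepth_le hb hab (hD φ ⟨by linarith, le_rfl⟩)
    have h2 : ellipseDepth a b φ (z φ) ≤ r₀ * τ / b := by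
      rw [le_div_iff₀ hb]
      linarith [him φ]
    have h3 : B * τ = C * τ + r₀ * τ / b := by rw [hB]; ring
    linarith
  have hD0 := hD (φ - τ) ⟨by linarith, by linarith⟩
  have h1 := pow_le_pow_left₀ hD0 hD3 2
  have h2 : 4 * B ^ 2 * τ * τ ≤ d₀ ^ 2 * τ := mul_le_mul_of_nonneg_right hτd hτp.le
  have h3 : 0 < B ^ 2 * τ ^ 2 := by positivity
  nlinarith

end

/-! ### The Lyapunov function and exponential stability -/

theorem le_of_hasDerivAt_nonpos_Ici {f f' : ℝ → ℝ} {u : ℝ} (hc : ContinuousOn f (Ici u))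
    (hf : ∀ t, u < t → HasDerivAt f (f' t) t) (h0 : ∀ t, u < t → f' t ≤ 0) {v : ℝ} (hv : u ≤ v) :
    f v ≤ f u := by
  have : AntitoneOn f (Ici u) := by
    apply antitoneOn_of_deriv_nonpos (convex_Ici u) hc
    · intro t ht
      rw [interior_Ici] at ht
      exact (hf t ht).differentiableAt.differentiableWithinAt
    · intro t ht
      rw [interior_Ici] at ht
      rw [(hf t ht).deriv]
      exact h0 t ht
  exact this self_mem_Ici hv hv

/-- Here `(u, v)` is the direction of `w`, and `(c, s)` are the cosine and sine of the angle from
`w` to `z`; no choice of argument is needed. -/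
theorem exists_polar_pair {z w : ℂ} (hz : z ≠ 0) (hw : w ≠ 0) : ∃ u v c s : ℝ,
    u ^ 2 + v ^ 2 = 1 ∧ c ^ 2 + s ^ 2 = 1 ∧ w.re = ‖w‖ * u ∧ w.im = ‖w‖ * v ∧
      z.re = ‖z‖ * (c * u - s * v) ∧ z.im = ‖z‖ * (s * u + c * v) := by
  have h : ∀ p : ℂ, p ≠ 0 → (p.re / ‖p‖) ^ 2 + (p.im / ‖p‖) ^ 2 = 1 ∧ p.re = ‖p‖ * (p.re / ‖p‖) ∧
      p.im = ‖p‖ * (p.im / ‖p‖) := by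
    intro p hp
    have h0 : ‖p‖ ≠ 0 := norm_ne_zero_iff.2 hp
    have h1 : ‖p‖ ^ 2 = p.re ^ 2 + p.im ^ 2 := by
      rw [← Complex.normSq_eq_norm_sq, Complex.normSq_apply]; ring
    refine ⟨?_, by field_simp, by field_simp⟩
    rw [div_pow, div_pow, ← add_div, ← h1, div_self (pow_ne_zero 2 h0)]
  obtain ⟨h1, h2, h3⟩ := h z hz
  obtain ⟨k1, k2, k3⟩ := h w hw
  set p := z.re / ‖z‖
  set q := z.im / ‖z‖
  set u := w.re / ‖w‖
  set v := w.im / ‖w‖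
  refine ⟨u, v, p * u + q * v, q * u - p * v, k1, ?_, k2, k3, ?_, ?_⟩
  · linear_combination (p ^ 2 + q ^ 2) * k1 + h1
  · linear_combination h2 - ‖z‖ * p * k1
  · linear_combination h3 - ‖z‖ * q * k1

theorem one_sub_nonneg_of_sq_add_sq {c s : ℝ} (h : c ^ 2 + s ^ 2 = 1) :
    0 ≤ 1 - c ∧ s ^ 2 ≤ 2 * (1 - c) := by
  constructor <;> nlinarith [sq_nonneg s, sq_nonneg (1 - c)]

set_option maxHeartbeats 1000000 in
/-- The algebraic core of the exponential stability: the derivative of the Lyapunov function. -/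
theorem exists_lyapunov_constants {n δ y₀ R g₀ g₁ : ℝ} (hn0 : 0 < n) (hn1 : n < 1) (hδ : 0 < δ)
    (hy₀ : 0 < y₀) (hR : 0 < R) (hg₀ : 0 < g₀) (hg₁ : 0 < g₁) :
    ∃ η > 0, ∃ l > 0, η * R ^ 2 ≤ 1 ∧ ∀ g r₁ r₂ u v c s : ℝ, g₀ ≤ g → g ≤ g₁ → 0 ≤ r₁ → r₁ ≤ R →
      δ ≤ r₂ → r₂ ≤ R → u ^ 2 + v ^ 2 = 1 → c ^ 2 + s ^ 2 = 1 → y₀ ≤ r₂ * v →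
      ∀ A B, A = r₁ * c - r₂ → B = r₁ * s →
      -(2 * n * g * (r₁ + r₂) * (1 - c)) - η * (r₂ * (g * v * (A ^ 2 - B ^ 2) + 2 * g * u * A * B -
        2 * n * g * A * B + n * g * r₂ * ((1 - c) * B - s * A))) ≤ -l * (A ^ 2 + B ^ 2) := by
  obtain ⟨a, ha⟩ : ∃ a, a = g₀ * y₀ := ⟨_, rfl⟩
  have hap : 0 < a := by rw [ha]; positivity
  obtain ⟨b, hb⟩ : ∃ b, b = 4 * R * g₁ := ⟨_, rfl⟩
  obtain ⟨d, hd⟩ : ∃ d, d = g₁ * R ^ 2 := ⟨_, rfl⟩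
  have hbp : 0 < b := by rw [hb]; positivity
  have hdp : 0 < d := by rw [hd]; positivity
  -- `M` collects every error that is controlled by `1 - c`: the transversal terms through `B² ≤ 2
  -- R² (1 - c)`, and those with `s` through `s² ≤ 2 (1 - c)`.
  obtain ⟨M, hM⟩ : ∃ M, M = 2 * R ^ 2 * (R * g₁ + b ^ 2 / a) + d * R + 2 * (d ^ 2 / a) := ⟨_, rfl⟩
  have hMp : 0 < M := by rw [hM]; positivity
  -- The first entry keeps the tilted function comparable to the squared distance. The second lets
  -- the errors consume at most half of the dissipation `2 n g₀ δ (1 - c)`; the other half controls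
  -- `B²`.
  obtain ⟨η, hη⟩ : ∃ η, η = min (1 / R ^ 2) (n * g₀ * δ / M) := ⟨_, rfl⟩
  have hηp : 0 < η := by rw [hη]; positivity
  have hη1 : η * R ^ 2 ≤ 1 := by
    rw [← le_div_iff₀ (by positivity), hη]; exact min_le_left _ _
  have hη2 : η * M ≤ n * g₀ * δ := by
    rw [← le_div_iff₀ (by positivity), hη]; exact min_le_right _ _
  obtain ⟨l, hl⟩ : ∃ l, l = min (η * a / 2) (n * g₀ * δ / (2 * R ^ 2)) := ⟨_, rfl⟩
  have hlp : 0 < l := by rw [hl]; positivity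
  have hl1 : l ≤ η * a / 2 := by rw [hl]; exact min_le_left _ _
  have hl2 : l * (2 * R ^ 2) ≤ n * g₀ * δ := by
    rw [← le_div_iff₀ (by positivity), hl]; exact min_le_right _ _
  refine ⟨η, hηp, l, hlp, hη1, ?_⟩
  intro g r₁ r₂ u v c s h1 h2 hr1 hr1R hr2 hr2R huv hcs hy A B hA hB
  obtain ⟨he, hse⟩ := one_sub_nonneg_of_sq_add_sq hcs
  have hg : 0 < g := hg₀.trans_le h1
  have hr2p : 0 < r₂ := hδ.trans_le hr2
  have hu : |u| ≤ 1 := by rw [← sq_le_one_iff_abs_le_one]; nlinarith [sq_nonneg v]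
  have hv : |v| ≤ 1 := by rw [← sq_le_one_iff_abs_le_one]; nlinarith [sq_nonneg u]
  have hs : |s| ≤ 1 := by rw [← sq_le_one_iff_abs_le_one]; nlinarith [sq_nonneg c]
  set e := 1 - c with hedef
  have hgr : g * r₂ ≤ R * g₁ := by rw [mul_comm R]; gcongr
  have hB2 : B ^ 2 ≤ 2 * R ^ 2 * e := by
    have : r₁ ^ 2 ≤ R ^ 2 := pow_le_pow_left₀ hr1 hr1R 2
    calc B ^ 2 = r₁ ^ 2 * s ^ 2 := by rw [hB]; ring
      _ ≤ R ^ 2 * (2 * e) := by gcongr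
      _ = _ := by ring
  have hBR : |B| ≤ R := by
    rw [hB, abs_mul, abs_of_nonneg hr1]
    calc r₁ * |s| ≤ R * 1 := by gcongr
      _ = R := mul_one R
  have t1 : a * A ^ 2 ≤ r₂ * g * v * A ^ 2 := by
    have : a ≤ r₂ * g * v := by
      calc a = g₀ * y₀ := ha
        _ ≤ g * (r₂ * v) := by gcongr
        _ = _ := by ring
    gcongr
  have t2 : r₂ * g * v * B ^ 2 ≤ R * g₁ * B ^ 2 := by
    have : r₂ * g * v ≤ R * g₁ := by
      calc r₂ * g * v ≤ r₂ * g * 1 := by gcongr; exact (le_abs_self v).trans hv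
        _ = g * r₂ := by ring
        _ ≤ _ := hgr
    gcongr
  have t3 : |r₂ * (2 * g * u * A * B - 2 * n * g * A * B)| ≤ b * (|A| * |B|) := by
    have h3 : r₂ * (2 * g * u * A * B - 2 * n * g * A * B) =
        2 * (g * r₂) * (u - n) * (A * B) := by ring
    have h4 : |u - n| ≤ 2 := by
      calc |u - n| ≤ |u| + |n| := abs_sub _ _
        _ ≤ 1 + 1 := by rw [abs_of_pos hn0]; gcongr
        _ = 2 := by norm_num
    rw [h3, abs_mul, abs_mul, abs_mul A, abs_of_pos (by positivity : 0 < 2 * (g * r₂))]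
    calc _ ≤ 2 * (R * g₁) * 2 * (|A| * |B|) := by gcongr
      _ = _ := by rw [hb]; ring
  have hngr : n * (g * r₂) * r₂ ≤ d := by
    calc n * (g * r₂) * r₂ ≤ 1 * (R * g₁) * R := by gcongr
      _ = d := by rw [hd]; ring
  have t4 : |n * (g * r₂) * r₂ * (e * B)| ≤ d * R * e := by
    rw [abs_mul, abs_mul e, abs_of_pos (by positivity : 0 < n * (g * r₂) * r₂), abs_of_nonneg he]
    calc _ ≤ d * (e * R) := by gcongr
      _ = _ := by ring
  have t5 : |n * (g * r₂) * r₂ * (s * A)| ≤ d * (|s| * |A|) := by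
    rw [abs_mul, abs_mul s, abs_of_pos (by positivity : 0 < n * (g * r₂) * r₂)]
    gcongr
  -- Applied twice, each time spending a quarter of the radial term `a A²`; half of it remains.
  have young : ∀ k p : ℝ, k * (|A| * p) ≤ a / 4 * A ^ 2 + k ^ 2 / a * p ^ 2 := by
    intro k p
    have h3 : 0 ≤ (a / 2 * |A| - k * p) ^ 2 / a := by positivity
    have h4 : (a / 2 * |A| - k * p) ^ 2 / a =
        a / 4 * |A| ^ 2 + k ^ 2 / a * p ^ 2 - k * (|A| * p) := by field_simp; ring
    rw [h4, sq_abs] at h3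
    linarith
  have t6 := young b |B|
  have t7 := young d |s|
  rw [sq_abs] at t6 t7
  have t8 : b ^ 2 / a * B ^ 2 + R * g₁ * B ^ 2 ≤ 2 * R ^ 2 * (R * g₁ + b ^ 2 / a) * e := by
    calc _ = (R * g₁ + b ^ 2 / a) * B ^ 2 := by ring
      _ ≤ (R * g₁ + b ^ 2 / a) * (2 * R ^ 2 * e) := by gcongr
      _ = _ := by ring
  have t9 : d ^ 2 / a * s ^ 2 ≤ 2 * (d ^ 2 / a) * e := by
    calc _ ≤ d ^ 2 / a * (2 * e) := by gcongr
      _ = _ := by ring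
  have hbr : a / 2 * A ^ 2 - M * e ≤ r₂ * (g * v * (A ^ 2 - B ^ 2) + 2 * g * u * A * B -
        2 * n * g * A * B + n * g * r₂ * (e * B - s * A)) := by
    have hMe : M * e = 2 * R ^ 2 * (R * g₁ + b ^ 2 / a) * e + d * R * e + 2 * (d ^ 2 / a) * e := by
      rw [hM]; ring
    have hsplit : r₂ * (g * v * (A ^ 2 - B ^ 2) + 2 * g * u * A * B -
        2 * n * g * A * B + n * g * r₂ * (e * B - s * A)) = r₂ * g * v * A ^ 2 - r₂ * g * v * B ^ 2 +
        r₂ * (2 * g * u * A * B - 2 * n * g * A * B) + n * (g * r₂) * r₂ * (e * B) -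
        n * (g * r₂) * r₂ * (s * A) := by ring
    rw [hsplit]
    have k3 := (abs_le.1 t3).1
    have k4 := (abs_le.1 t4).1
    have k5 := (abs_le.1 t5).2
    have k6 : |s| * |A| = |A| * |s| := mul_comm _ _
    rw [k6] at k5
    linarith
  have hfirst : 2 * (n * g₀ * δ) * e ≤ 2 * n * g * (r₁ + r₂) * e := by
    have : δ ≤ r₁ + r₂ := by linarith
    calc _ = 2 * n * g₀ * δ * e := by ring
      _ ≤ _ := by gcongr
  have k1 := mul_le_mul_of_nonneg_left hbr hηp.le
  have k2 := mul_le_mul_of_nonneg_right hη2 he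
  have k3 : l * A ^ 2 ≤ η * a / 2 * A ^ 2 := by gcongr
  have k4 : l * B ^ 2 ≤ n * g₀ * δ * e := by
    calc l * B ^ 2 ≤ l * (2 * R ^ 2 * e) := by gcongr
      _ = l * (2 * R ^ 2) * e := by ring
      _ ≤ _ := by gcongr
  linarith

section
variable {a b n : ℝ}

theorem IsComplexPursuitSolutionOn.continuousOn {z : ℝ → ℂ} {s : Set ℝ}
    (hz : IsComplexPursuitSolutionOn a b n z s) : ContinuousOn z s :=
  fun t ht => (hz t ht).2.continuousWithinAt

theorem IsComplexPursuitSolutionOn.hasDerivAt_re {z : ℝ → ℂ} {φ₀ φ : ℝ}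
    (hz : IsComplexPursuitSolutionOn a b n z (Ici φ₀)) (hφ : φ₀ < φ) {p : ℝ}
    (hp : (z φ).re = ‖z φ‖ * p) :
    HasDerivAt (fun t => (z t).re)
      ((turningRate a b φ)⁻¹ - n * (turningRate a b φ)⁻¹ * p - (z φ).im) φ := by
  obtain ⟨h0, h⟩ := hz φ hφ.le
  have h1 := (h.hasDerivAt (Ici_mem_nhds hφ))
  have hne : ‖z φ‖ ≠ 0 := norm_ne_zero_iff.2 h0
  refine (_root_.hasDerivAt_re h1).congr_deriv ?_
  have h2 : 1 / (turningRate a b φ : ℂ) - (n : ℂ) / (turningRate a b φ : ℂ) *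
      (z φ / (‖z φ‖ : ℂ)) + Complex.I * z φ = ((turningRate a b φ)⁻¹ : ℝ) -
      ((n * (turningRate a b φ)⁻¹ * ‖z φ‖⁻¹ : ℝ) : ℂ) * z φ + Complex.I * z φ := by
    push_cast; ring
  rw [h2]
  simp only [Complex.add_re, Complex.sub_re, Complex.ofReal_re, Complex.re_ofReal_mul,
    Complex.I_mul_re, hp]
  field_simp
  ring

theorem IsComplexPursuitSolutionOn.hasDerivAt_im {z : ℝ → ℂ} {φ₀ φ : ℝ}
    (hz : IsComplexPursuitSolutionOn a b n z (Ici φ₀)) (hφ : φ₀ < φ) {p : ℝ}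
    (hp : (z φ).im = ‖z φ‖ * p) :
    HasDerivAt (fun t => (z t).im)
      ((z φ).re - n * (turningRate a b φ)⁻¹ * p) φ := by
  obtain ⟨h0, h⟩ := hz φ hφ.le
  have h1 := (h.hasDerivAt (Ici_mem_nhds hφ))
  have hne : ‖z φ‖ ≠ 0 := norm_ne_zero_iff.2 h0
  refine (_root_.hasDerivAt_im h1).congr_deriv ?_
  have h2 : 1 / (turningRate a b φ : ℂ) - (n : ℂ) / (turningRate a b φ : ℂ) *
      (z φ / (‖z φ‖ : ℂ)) + Complex.I * z φ = ((turningRate a b φ)⁻¹ : ℝ) -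
      ((n * (turningRate a b φ)⁻¹ * ‖z φ‖⁻¹ : ℝ) : ℂ) * z φ + Complex.I * z φ := by
    push_cast; ring
  rw [h2]
  simp only [Complex.add_im, Complex.sub_im, Complex.ofReal_im, Complex.im_ofReal_mul,
    Complex.I_mul_im, hp]
  field_simp
  ring

/-- The squared distance of two states, tilted by a small multiple of the product of the
components of their difference along and across the second state. -/
noncomputable def pursuitLyapunov (η : ℝ) (z w : ℂ) : ℝ :=
  (z.re - w.re) ^ 2 + (z.im - w.im) ^ 2 -
    η * (((z.re - w.re) * w.re + (z.im - w.im) * w.im) *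
      ((z.im - w.im) * w.re - (z.re - w.re) * w.im))

theorem continuousOn_pursuitLyapunov {z w : ℝ → ℂ} {s : Set ℝ} (hz : ContinuousOn z s)
    (hw : ContinuousOn w s) (η : ℝ) : ContinuousOn (fun t => pursuitLyapunov η (z t) (w t)) s := by
  have h1 : ContinuousOn (fun t => (z t).re) s := Complex.continuous_re.comp_continuousOn hz
  have h2 : ContinuousOn (fun t => (z t).im) s := Complex.continuous_im.comp_continuousOn hz
  have h3 : ContinuousOn (fun t => (w t).re) s := Complex.continuous_re.comp_continuousOn hw
  have h4 : ContinuousOn (fun t => (w t).im) s := Complex.continuous_im.comp_continuousOn hw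
  unfold pursuitLyapunov
  fun_prop

/-- `A` and `B` are the components of `z - w` along and across `w`. The squared distance only
dissipates through the angle; the tilt contributes `-η ‖w‖ g v A²`, which is the missing radial
dissipation when `v > 0`. -/
theorem hasDerivAt_pursuitLyapunov {z w : ℝ → ℂ} {φ₀ φ : ℝ}
    (hz : IsComplexPursuitSolutionOn a b n z (Ici φ₀))
    (hw : IsComplexPursuitSolutionOn a b n w (Ici φ₀)) (hφ : φ₀ < φ) (η : ℝ) {u v c s : ℝ}
    (huv : u ^ 2 + v ^ 2 = 1) (hcs : c ^ 2 + s ^ 2 = 1) (hwr : (w φ).re = ‖w φ‖ * u)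
    (hwi : (w φ).im = ‖w φ‖ * v) (hzr : (z φ).re = ‖z φ‖ * (c * u - s * v))
    (hzi : (z φ).im = ‖z φ‖ * (s * u + c * v)) {A B g : ℝ} (hA : A = ‖z φ‖ * c - ‖w φ‖)
    (hB : B = ‖z φ‖ * s) (hg : g = (turningRate a b φ)⁻¹) :
    HasDerivAt (fun t => pursuitLyapunov η (z t) (w t))
      (-(2 * n * g * (‖z φ‖ + ‖w φ‖) * (1 - c)) - η * (‖w φ‖ * (g * v * (A ^ 2 - B ^ 2) +
        2 * g * u * A * B - 2 * n * g * A * B + n * g * ‖w φ‖ * ((1 - c) * B - s * A)))) φ := by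
  have hx1 := hz.hasDerivAt_re hφ hzr
  have hy1 := hz.hasDerivAt_im hφ hzi
  have hx2 := hw.hasDerivAt_re hφ hwr
  have hy2 := hw.hasDerivAt_im hφ hwi
  rw [← hg] at hx1 hy1 hx2 hy2
  have hdx := hx1.sub hx2
  have hdy := hy1.sub hy2
  refine (((hdx.pow 2).add (hdy.pow 2)).sub ((((hdx.mul hx2).add (hdy.mul hy2)).mul
    ((hdy.mul hx2).sub (hdx.mul hy2))).const_mul η)).congr_deriv ?_
  simp only [Pi.sub_apply, Pi.add_apply, Pi.mul_apply, hwr, hwi, hzr, hzi]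
  set r₁ := ‖z φ‖
  set r₂ := ‖w φ‖
  have e1 : r₁ * (c * u - s * v) - r₂ * u = u * A - v * B := by rw [hA, hB]; ring
  have e2 : r₁ * (s * u + c * v) - r₂ * v = v * A + u * B := by rw [hA, hB]; ring
  have e3 : g - n * g * (c * u - s * v) - r₁ * (s * u + c * v) - (g - n * g * u - r₂ * v) =
      -(n * g) * (u * (c - 1) - v * s) - (v * A + u * B) := by rw [hA, hB]; ring
  have e4 : r₁ * (c * u - s * v) - n * g * (s * u + c * v) - (r₂ * u - n * g * v) =
      (u * A - v * B) - n * g * (v * (c - 1) + u * s) := by rw [hA, hB]; ring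
  rw [e1, e2, e3, e4]
  have f1 : (u * A - v * B) * (r₂ * u) + (v * A + u * B) * (r₂ * v) = r₂ * A := by
    linear_combination r₂ * A * huv
  have f2 : (v * A + u * B) * (r₂ * u) - (u * A - v * B) * (r₂ * v) = r₂ * B := by
    linear_combination r₂ * B * huv
  have f3 : (-(n * g) * (u * (c - 1) - v * s) - (v * A + u * B)) * (r₂ * u) +
      (u * A - v * B) * (g - n * g * u - r₂ * v) +
      (((u * A - v * B) - n * g * (v * (c - 1) + u * s)) * (r₂ * v) +
      (v * A + u * B) * (r₂ * u - n * g * v)) =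
      n * g * r₂ * (1 - c) + g * (u * A - v * B) - n * g * A := by
    linear_combination (n * g * r₂ * (1 - c) - n * g * A) * huv
  have f4 : ((u * A - v * B) - n * g * (v * (c - 1) + u * s)) * (r₂ * u) +
      (v * A + u * B) * (g - n * g * u - r₂ * v) -
      ((-(n * g) * (u * (c - 1) - v * s) - (v * A + u * B)) * (r₂ * v) +
      (u * A - v * B) * (r₂ * u - n * g * v)) =
      -(n * g * r₂ * s) + g * (v * A + u * B) - n * g * B := by
    linear_combination (-(n * g * r₂ * s) - n * g * B) * huv
  rw [f1, f2, f3, f4]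
  -- For the squared distance the rotation and the common term `1 / f` cancel; what is left pairs `z
  -- - w` with the difference of the unit vectors.
  have f5 : ((2 : ℕ) : ℝ) * (u * A - v * B) ^ (2 - 1) *
      (-(n * g) * (u * (c - 1) - v * s) - (v * A + u * B)) +
      ((2 : ℕ) : ℝ) * (v * A + u * B) ^ (2 - 1) *
      ((u * A - v * B) - n * g * (v * (c - 1) + u * s)) =
      -(2 * n * g * (r₁ + r₂) * (1 - c)) := by
    have f6 : A * (c - 1) + B * s = (r₁ + r₂) * (1 - c) := by
      rw [hA, hB]; linear_combination r₁ * hcs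
    push_cast
    linear_combination (-(2 * n * g)) * (A * (c - 1) + B * s) * huv - 2 * n * g * f6
  rw [f5]
  ring

theorem sq_norm_sub_eq {z w : ℂ} {u v c s : ℝ} (huv : u ^ 2 + v ^ 2 = 1)
    (hwr : w.re = ‖w‖ * u) (hwi : w.im = ‖w‖ * v) (hzr : z.re = ‖z‖ * (c * u - s * v))
    (hzi : z.im = ‖z‖ * (s * u + c * v)) :
    ‖z - w‖ ^ 2 = (‖z‖ * c - ‖w‖) ^ 2 + (‖z‖ * s) ^ 2 := by
  rw [← Complex.normSq_eq_norm_sq, Complex.normSq_apply, Complex.sub_re, Complex.sub_im,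
    hwr, hwi, hzr, hzi]
  linear_combination ((‖z‖ * c - ‖w‖) ^ 2 + (‖z‖ * s) ^ 2) * huv

theorem pursuitLyapunov_zero (z w : ℂ) : pursuitLyapunov 0 z w = ‖z - w‖ ^ 2 := by
  rw [← Complex.normSq_eq_norm_sq, Complex.normSq_apply, Complex.sub_re, Complex.sub_im,
    pursuitLyapunov]
  ring

theorem abs_pursuitLyapunov_sub_le {η R : ℝ} (hη : 0 ≤ η) (hR : η * R ^ 2 ≤ 1) (z : ℂ) {w : ℂ}
    (hw : ‖w‖ ≤ R) : |pursuitLyapunov η z w - ‖z - w‖ ^ 2| ≤ ‖z - w‖ ^ 2 / 2 := by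
  obtain ⟨p, hp⟩ : ∃ p, p = z.re - w.re := ⟨_, rfl⟩
  obtain ⟨q, hq⟩ : ∃ q, q = z.im - w.im := ⟨_, rfl⟩
  have h1 : ‖z - w‖ ^ 2 = p ^ 2 + q ^ 2 := by
    rw [← Complex.normSq_eq_norm_sq, Complex.normSq_apply, Complex.sub_re, Complex.sub_im, hp, hq]
    ring
  have h2 : ‖w‖ ^ 2 = w.re ^ 2 + w.im ^ 2 := by
    rw [← Complex.normSq_eq_norm_sq, Complex.normSq_apply]; ring
  have h3 : pursuitLyapunov η z w - ‖z - w‖ ^ 2 =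
      -(η * ((p * w.re + q * w.im) * (q * w.re - p * w.im))) := by
    rw [pursuitLyapunov, h1, hp, hq]; ring
  have h4 : |(p * w.re + q * w.im) * (q * w.re - p * w.im)| ≤ (p ^ 2 + q ^ 2) * ‖w‖ ^ 2 / 2 := by
    rw [h2, abs_le]
    constructor
    · linarith [sq_nonneg ((p * w.re + q * w.im) + (q * w.re - p * w.im))]
    · linarith [sq_nonneg ((p * w.re + q * w.im) - (q * w.re - p * w.im))]
  rw [h3, abs_neg, abs_mul, abs_of_nonneg hη, h1]
  have h5 : ‖w‖ ^ 2 ≤ R ^ 2 := pow_le_pow_left₀ (norm_nonneg w) hw 2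
  calc η * |(p * w.re + q * w.im) * (q * w.re - p * w.im)|
      ≤ η * ((p ^ 2 + q ^ 2) * R ^ 2 / 2) := by
        refine mul_le_mul_of_nonneg_left (h4.trans ?_) hη
        linarith [mul_le_mul_of_nonneg_left h5 (by positivity : 0 ≤ p ^ 2 + q ^ 2)]
    _ = η * R ^ 2 * ((p ^ 2 + q ^ 2) / 2) := by ring
    _ ≤ 1 * ((p ^ 2 + q ^ 2) / 2) := by gcongr
    _ = _ := one_mul _

/-- The distance of two solutions does not increase. -/
theorem norm_sub_le_of_isComplexPursuitSolutionOn (hb : 0 < b) (hab : b ≤ a) (hn0 : 0 < n)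
    {z w : ℝ → ℂ} {φ₀ : ℝ} (hz : IsComplexPursuitSolutionOn a b n z (Ici φ₀))
    (hw : IsComplexPursuitSolutionOn a b n w (Ici φ₀)) {φ : ℝ} (hφ : φ₀ ≤ φ) :
    ‖z φ - w φ‖ ≤ ‖z φ₀ - w φ₀‖ := by
  have hc : ContinuousOn (fun t => pursuitLyapunov 0 (z t) (w t)) (Ici φ₀) :=
    continuousOn_pursuitLyapunov hz.continuousOn hw.continuousOn 0
  have h : ∀ t, φ₀ < t → ∃ D ≤ 0, HasDerivAt (fun t => pursuitLyapunov 0 (z t) (w t)) D t := by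
    intro t ht
    obtain ⟨u, v, c, s, huv, hcs, hwr, hwi, hzr, hzi⟩ :=
      exists_polar_pair (hz t ht.le).1 (hw t ht.le).1
    refine ⟨_, ?_, hasDerivAt_pursuitLyapunov hz hw ht 0 huv hcs hwr hwi hzr hzi rfl rfl rfl⟩
    have hg0 := inv_pos.2 (turningRate_pos hb hab t)
    have he := (one_sub_nonneg_of_sq_add_sq hcs).1
    rw [zero_mul, sub_zero, neg_nonpos]
    positivity
  choose! D hD0 hD using h
  have h1 := le_of_hasDerivAt_nonpos_Ici hc hD hD0 hφ
  rw [pursuitLyapunov_zero, pursuitLyapunov_zero] at h1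
  exact (pow_le_pow_iff_left₀ (norm_nonneg _) (norm_nonneg _) two_ne_zero).1 h1

/-- Exponential stability of solutions that stay uniformly away from the real axis. -/
theorem exists_exponential_decay (hb : 0 < b) (hab : b ≤ a) (hn0 : 0 < n) (hn1 : n < 1)
    {y₀ : ℝ} (hy₀ : 0 < y₀) (R : ℝ) : ∃ l > 0, ∀ (z w : ℝ → ℂ) (φ₀ : ℝ),
      IsComplexPursuitSolutionOn a b n z (Ici φ₀) → IsComplexPursuitSolutionOn a b n w (Ici φ₀) →
      (∀ φ, φ₀ ≤ φ → ‖z φ‖ ≤ R) → (∀ φ, φ₀ ≤ φ → ‖w φ‖ ≤ R) →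
      (∀ φ, φ₀ ≤ φ → y₀ ≤ (w φ).im) →
      ∀ φ, φ₀ ≤ φ → ‖z φ - w φ‖ ^ 2 ≤ 3 * ‖z φ₀ - w φ₀‖ ^ 2 * Real.exp (-(l * (φ - φ₀))) := by
  have ha : 0 < a := by linarith
  rcases le_or_gt R 0 with hR | hR
  -- With `R ≤ 0` the bound `‖z‖ ≤ R` contradicts `z ≠ 0`, so any rate will do.
  · refine ⟨1, one_pos, fun z w φ₀ hz _ hzR _ _ φ _ => ?_⟩
    exact absurd ((norm_pos_iff.2 (hz φ₀ self_mem_Ici).1).trans_le (hzR φ₀ le_rfl)) hR.not_gt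
  obtain ⟨η, hη, l, hl, hηR, hkey⟩ := exists_lyapunov_constants hn0 hn1 hy₀ hy₀ hR
    (g₀ := b ^ 2 / a) (g₁ := a ^ 2 / b) (by positivity) (by positivity)
  -- From `V ≤ (3/2) ‖z - w‖²` the decay rate of `V` is at least `2 l / 3`, so `l / 2` is safe. The
  -- factor 3 in the conclusion is the ratio of the comparison constants `3/2` and `1/2`.
  refine ⟨l / 2, by positivity, fun z w φ₀ hz hw hzR hwR hwy φ hφ => ?_⟩
  have hwn : ∀ φ, φ₀ ≤ φ → y₀ ≤ ‖w φ‖ := fun t ht =>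
    (hwy t ht).trans ((le_abs_self _).trans (Complex.abs_im_le_norm _))
  have hbd : ∀ t, φ₀ ≤ t → ‖z t - w t‖ ^ 2 / 2 ≤ pursuitLyapunov η (z t) (w t) ∧
      pursuitLyapunov η (z t) (w t) ≤ 3 / 2 * ‖z t - w t‖ ^ 2 := by
    intro t ht
    have := abs_le.1 (abs_pursuitLyapunov_sub_le hη.le hηR (z t) (hwR t ht))
    constructor <;> linarith [this.1, this.2]
  have hc : ContinuousOn (fun t => pursuitLyapunov η (z t) (w t) * Real.exp (l / 2 * (t - φ₀)))
      (Ici φ₀) :=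
    (continuousOn_pursuitLyapunov hz.continuousOn hw.continuousOn η).mul (by fun_prop)
  have h : ∀ t, φ₀ < t → ∃ D ≤ 0, HasDerivAt
      (fun t => pursuitLyapunov η (z t) (w t) * Real.exp (l / 2 * (t - φ₀))) D t := by
    intro t ht
    obtain ⟨u, v, c, s, huv, hcs, hwr, hwi, hzr, hzi⟩ :=
      exists_polar_pair (hz t ht.le).1 (hw t ht.le).1
    have hV := hasDerivAt_pursuitLyapunov hz hw ht η huv hcs hwr hwi hzr hzi rfl rfl rfl
    have hV' := hkey (turningRate a b t)⁻¹ ‖z t‖ ‖w t‖ u v c s (le_turningRate_inv hb hab t)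
      (turningRate_inv_le hb hab t) (norm_nonneg _) (hzR t ht.le) (hwn t ht.le) (hwR t ht.le)
      huv hcs (hwi ▸ hwy t ht.le) _ _ rfl rfl
    rw [← sq_norm_sub_eq huv hwr hwi hzr hzi] at hV'
    have hlin : HasDerivAt (fun t => l / 2 * (t - φ₀)) (l / 2) t := by
      simpa using ((hasDerivAt_id t).sub_const φ₀).const_mul (l / 2)
    refine ⟨_, ?_, hV.mul hlin.exp⟩
    have h1 := (hbd t ht.le).2
    have h2 : pursuitLyapunov η (z t) (w t) * (l / 2) ≤ l * ‖z t - w t‖ ^ 2 := by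
      have := mul_le_mul_of_nonneg_right h1 (by positivity : 0 ≤ l / 2)
      have h3 : 0 ≤ l * ‖z t - w t‖ ^ 2 := by positivity
      linarith
    have h3 := Real.exp_pos (l / 2 * (t - φ₀))
    have h4 := mul_le_mul_of_nonneg_right (add_le_add hV' h2) h3.le
    rw [neg_mul, neg_add_cancel, zero_mul] at h4
    refine le_trans (le_of_eq ?_) h4
    ring
  choose! D hD0 hD using h
  have h1 := le_of_hasDerivAt_nonpos_Ici hc hD hD0 hφ
  simp only [sub_self, mul_zero, Real.exp_zero, mul_one] at h1
  have h2 := (hbd φ hφ).1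
  have h3 := (hbd φ₀ le_rfl).2
  rw [Real.exp_neg, ← div_eq_mul_inv, le_div_iff₀ (Real.exp_pos _)]
  have h4 := mul_le_mul_of_nonneg_right h2 (Real.exp_pos (l / 2 * (φ - φ₀))).le
  linarith

end

/-! ### Existence of a periodic solution -/

theorem Function.Periodic.eq_zero_of_tendsto {E : Type*} [TopologicalSpace E] [T2Space E]
    [Zero E] {f : ℝ → E} {c : ℝ} (hc : 0 < c) (hf : Function.Periodic f c)
    (h : Tendsto f atTop (𝓝 0)) (x : ℝ) : f x = 0 := by
  have h1 : Tendsto (fun k : ℕ => x + k * c) atTop atTop :=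
    tendsto_atTop_add_const_left _ _ (tendsto_natCast_atTop_atTop.atTop_mul_const hc)
  have h2 := h.comp h1
  have h3 : (f ∘ fun k : ℕ => x + k * c) = fun _ => f x := funext fun k => hf.nat_mul k x
  rw [h3] at h2
  exact tendsto_nhds_unique tendsto_const_nhds h2

section
variable {a b n : ℝ}

theorem IsTruncatedSolution.isComplexPursuitSolutionOn {ε : ℝ} (hε : 0 < ε) {z : ℝ → ℂ}
    (hz : IsTruncatedSolution a b n ε z) {s : Set ℝ} (hs : ∀ φ ∈ s, ε ≤ ‖z φ‖) :
    IsComplexPursuitSolutionOn a b n z s := by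
  intro φ hφ
  have h0 := hs φ hφ
  refine ⟨norm_pos_iff.1 (hε.trans_le h0), (hz φ).hasDerivWithinAt.congr_deriv ?_⟩
  rw [truncatedField, cutoffUnit, max_eq_left h0, Complex.real_smul, Complex.real_smul]
  push_cast
  ring

/-- A truncated pursuit that starts at the centre of the ellipse ends up in a region that is
uniformly far from capture. -/
theorem exists_bounded_truncatedSolution (hb : 0 < b) (hab : b ≤ a) (hn0 : 0 < n) (hn1 : n < 1) :
    ∃ ε > 0, ∃ y₀ > 0, ∃ R, ∃ z : ℝ → ℂ, IsTruncatedSolution a b n ε z ∧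
      ∀ φ, 0 ≤ φ → ε ≤ ‖z φ‖ ∧ ‖z φ‖ ≤ R ∧ y₀ ≤ (z φ).im := by
  have ha : 0 < a := by linarith
  obtain ⟨δ, hδ, T, hT, hfar⟩ := exists_lt_norm_of_ellipseDepth_nonneg hb hab hn0 hn1
  -- The cutoff is taken equal to the capture bound `δ`, so it is inactive from time `T` on. The
  -- initial value `b i` puts the pursuer at the centre, at depth 1.
  obtain ⟨z, hz0, hz⟩ := exists_truncatedSolution (n := n) hb hab hn0 hδ 0 (b * Complex.I)
  have hD0 : ellipseDepth a b 0 (z 0) = 1 := by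
    have hs : supportFun a b 0 = b := by simp [supportFun, Real.sqrt_sq hb.le]
    rw [hz0, ellipseDepth, hs, ellipticSq]
    simp
    field_simp
    norm_num
  have hD : ∀ φ, 0 ≤ φ → 0 ≤ ellipseDepth a b φ (z φ) := fun φ hφ =>
    hz.ellipseDepth_nonneg hb hab hn0 hδ (by rw [hD0]; exact zero_le_one) hφ
  have hR : ∀ φ, 0 ≤ φ → ‖z φ‖ ≤ 2 * a ^ 2 / b := fun φ hφ =>
    norm_le_of_ellipseDepth_nonneg hb hab (hD φ hφ)
  have hr : ∀ φ, T ≤ φ → δ ≤ ‖z φ‖ := fun φ hφ =>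
    (hfar δ hδ le_rfl z hz φ fun t ht => hD t (by linarith [ht.1])).le
  obtain ⟨R, hRdef⟩ : ∃ R, R = 2 * a ^ 2 / b := ⟨_, rfl⟩
  rw [← hRdef] at hR
  have hRp : 0 < R := by rw [hRdef]; positivity
  have hδR : δ ≤ R := (hr T le_rfl).trans (hR T hT.le)
  obtain ⟨d, hd⟩ : ∃ d, d = Real.exp (-(n * (a ^ 2 / b) / δ * 1)) *
      (n * (b ^ 2 / a) / R * (δ ^ 2 / a ^ 2) * 1) := ⟨_, rfl⟩
  have hdp : 0 < d := by rw [hd]; positivity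
  -- On the window `[φ - 1, φ]` the norm lies between `δ` and `R`, so the relaxation equation
  -- produces a definite depth.
  have hDd : ∀ φ, T + 1 ≤ φ → d ≤ ellipseDepth a b φ (z φ) := by
    intro φ hφ
    have h := exp_mul_le_of_relaxation (D := fun t => ellipseDepth a b t (z t))
      (κ := fun t => pursuitRate a b n δ t (z t)) (Q := fun t => ellipticSq a b t (z t))
      (u := φ - 1) (v := φ) (κ₁ := n * (b ^ 2 / a) / R) (κ₂ := n * (a ^ 2 / b) / δ)
      (q := δ ^ 2 / a ^ 2) (by linarith) (by positivity) (by positivity)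
      (fun t ht => hD t (by linarith [ht.1])) (fun t _ => hz.hasDerivAt_ellipseDepth hb hab t)
      (fun t ht => ⟨le_pursuitRate hb hab hn0 hδ hδR (hR t (by linarith [ht.1])),
        pursuitRate_le hb hab hn0 hδ (hr t (by linarith [ht.1]))⟩)
      (fun t ht => by
        refine le_trans ?_ (sq_norm_le_ellipticSq hb hab t (z t))
        have := hr t (by linarith [ht.1])
        gcongr)
    rw [sub_sub_cancel, ← hd] at h
    exact h
  obtain ⟨k, hk⟩ := exists_nat_ge ((T + 1) / Real.pi)
  rw [div_le_iff₀ Real.pi_pos] at hk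
  -- A shift by whole periods past `T + 1` makes all bounds hold from time 0.
  refine ⟨δ, hδ, b * d / 2, by positivity, R, fun φ => z (φ + k * Real.pi), hz.comp_add k,
    fun φ hφ => ⟨hr _ (by linarith), hR _ (by linarith), ?_⟩⟩
  have h1 := hDd (φ + k * Real.pi) (by linarith)
  have h2 := mul_ellipseDepth_le hb hab (hdp.le.trans h1)
  have h3 := mul_le_mul_of_nonneg_left h1 hb.le
  linarith

/-- The complex equation has a periodic solution uniformly inside the upper half-plane. -/
theorem exists_isPeriodicComplexPursuitSolution (hb : 0 < b) (hab : b ≤ a) (hn0 : 0 < n)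
    (hn1 : n < 1) : ∃ y₀ > 0, ∃ R, ∃ z : ℝ → ℂ, IsPeriodicComplexPursuitSolution a b n z ∧
      ∀ φ, ‖z φ‖ ≤ R ∧ y₀ ≤ (z φ).im := by
  obtain ⟨ε, hε, y₀, hy₀, R, z, hz, hzb⟩ := exists_bounded_truncatedSolution hb hab hn0 hn1
  obtain ⟨l, hl, hdecay⟩ := exists_exponential_decay hb hab hn0 hn1 hy₀ R
  have hπ := Real.pi_pos
  have hshift : ∀ k : ℕ, ∀ φ : ℝ, 0 ≤ φ → 0 ≤ φ + k * Real.pi := fun k φ hφ => by positivity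
  -- The shift of `z` by `π` is again a solution; the decay estimate for the two solutions, at time
  -- `k π`, yields a geometric bound.
  have hdist : ∀ k : ℕ, dist (z (k * Real.pi)) (z ((k + 1 : ℕ) * Real.pi)) ≤
      Real.sqrt 3 * ‖z (0 + (1 : ℕ) * Real.pi) - z 0‖ * Real.exp (-(l * Real.pi / 2)) ^ k := by
    intro k
    have h := hdecay (fun φ => z (φ + (1 : ℕ) * Real.pi)) z 0
      ((hz.comp_add 1).isComplexPursuitSolutionOn hε fun φ hφ => (hzb _ (hshift 1 φ hφ)).1)
      (hz.isComplexPursuitSolutionOn hε fun φ hφ => (hzb φ hφ).1)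
      (fun φ hφ => (hzb _ (hshift 1 φ hφ)).2.1) (fun φ hφ => (hzb φ hφ).2.1)
      (fun φ hφ => (hzb φ hφ).2.2) (k * Real.pi) (by positivity)
    have h1 : z ((k + 1 : ℕ) * Real.pi) = z (k * Real.pi + (1 : ℕ) * Real.pi) := by
      congr 1; push_cast; ring
    rw [h1, dist_comm, dist_eq_norm]
    apply le_of_sq_le_sq _ (by positivity)
    refine h.trans (le_of_eq ?_)
    rw [mul_pow, mul_pow, Real.sq_sqrt (by norm_num), ← Real.exp_nat_mul, ← Real.exp_nat_mul]
    congr 2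
    push_cast
    ring
  have hρ : Real.exp (-(l * Real.pi / 2)) < 1 := by
    rw [Real.exp_lt_one_iff]
    have : 0 < l * Real.pi := by positivity
    linarith
  obtain ⟨p, hp⟩ := cauchySeq_tendsto_of_complete (cauchySeq_of_le_geometric _ _ hρ hdist)
  obtain ⟨w, hw0, hw⟩ := exists_truncatedSolution (n := n) hb hab hn0 hε 0 p
  obtain ⟨K, hK⟩ := lipschitzWith_truncatedField (n := n) hb hab hn0 hε
  have hlim : ∀ φ : ℝ, 0 ≤ φ → Tendsto (fun k : ℕ => z (φ + k * Real.pi)) atTop (𝓝 (w φ)) := by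
    intro φ hφ
    have h1 : ∀ k : ℕ, dist (z (φ + k * Real.pi)) (w φ) ≤
        dist (z (k * Real.pi)) p * Real.exp (K * φ) := by
      intro k
      have hk := hz.comp_add k
      have := dist_le_of_trajectories_ODE (v := truncatedField a b n ε) (K := K)
        (f := fun t => z (t + k * Real.pi)) (g := w) (a := 0) (b := φ)
        (δ := dist (z (k * Real.pi)) p) hK hk.continuous.continuousOn
        (fun t _ => (hk t).hasDerivWithinAt) hw.continuous.continuousOn
        (fun t _ => (hw t).hasDerivWithinAt) (by rw [hw0, zero_add]) φ ⟨hφ, le_rfl⟩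
      simpa using this
    rw [tendsto_iff_dist_tendsto_zero]
    refine squeeze_zero (fun _ => dist_nonneg) h1 ?_
    have := (tendsto_iff_dist_tendsto_zero.1 hp).mul_const (Real.exp (K * φ))
    rwa [zero_mul] at this
  -- The shifted sequence has the same limit, so `w π = w 0`, and uniqueness for the truncated
  -- equation extends this to all times.
  have hper : Function.Periodic w Real.pi := by
    have h1 : Tendsto (fun k : ℕ => z (Real.pi + k * Real.pi)) atTop (𝓝 p) := by
      have := hp.comp (tendsto_add_atTop_nat 1)
      refine this.congr fun k => ?_
      simp only [Function.comp]
      congr 1; push_cast; ring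
    have h2 : w Real.pi = p := tendsto_nhds_unique (hlim Real.pi hπ.le) h1
    have h3 := (hw.comp_add 1).eq_of_eq hb hab hn0 hε hw (φ₀ := 0) (by simp [h2, hw0])
    intro φ
    have := congrFun h3 φ
    simpa using this
  have hbd : ∀ φ, ε ≤ ‖w φ‖ ∧ ‖w φ‖ ≤ R ∧ y₀ ≤ (w φ).im := by
    intro φ
    obtain ⟨k, hk⟩ := exists_nat_ge (-φ / Real.pi)
    rw [div_le_iff₀ hπ] at hk
    have h0 : 0 ≤ φ + k * Real.pi := by linarith
    have h1 := hlim _ h0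
    rw [hper.nat_mul k φ] at h1
    have hb' : ∀ j : ℕ, _ := fun j => hzb _ (hshift j _ h0)
    exact ⟨ge_of_tendsto' h1.norm fun j => (hb' j).1, le_of_tendsto' h1.norm fun j => (hb' j).2.1,
      ge_of_tendsto' ((Complex.continuous_im.tendsto _).comp h1) fun j => (hb' j).2.2⟩
  exact ⟨y₀, hy₀, R, w, ⟨hw.isComplexPursuitSolutionOn hε fun φ _ => (hbd φ).1, hper⟩,
    fun φ => (hbd φ).2⟩

/-! ### Passage between the polar and the complex form -/

theorem IsComplexPursuitSolutionOn.mono {z : ℝ → ℂ} {s t : Set ℝ}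
    (hz : IsComplexPursuitSolutionOn a b n z t) (h : s ⊆ t) :
    IsComplexPursuitSolutionOn a b n z s :=
  fun φ hφ => ⟨(hz φ (h hφ)).1, (hz φ (h hφ)).2.mono h⟩

theorem IsPursuitSolutionOn.mono {μ ζ : ℝ → ℝ} {s t : Set ℝ}
    (hz : IsPursuitSolutionOn a b n μ ζ t) (h : s ⊆ t) :
    IsPursuitSolutionOn a b n μ ζ s :=
  fun φ hφ => ⟨(hz φ (h hφ)).1.mono h, (hz φ (h hφ)).2.mono h⟩

theorem norm_complexState (μ ζ : ℝ → ℝ) (φ : ℝ) : ‖complexState μ ζ φ‖ = Real.exp (μ φ) := by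
  simp [complexState, Complex.norm_exp]

theorem complexState_ne_zero (μ ζ : ℝ → ℝ) (φ : ℝ) : complexState μ ζ φ ≠ 0 :=
  Complex.exp_ne_zero _

/-- The complex equation and the pursuit system agree under `z = e^(μ + i ζ)`. -/
theorem complexField_eq {f : ℝ} (hf : f ≠ 0) (μ ζ : ℝ → ℝ) (φ : ℝ) :
    1 / (f : ℂ) - (n : ℂ) / (f : ℂ) * (complexState μ ζ φ / (‖complexState μ ζ φ‖ : ℂ)) +
        Complex.I * complexState μ ζ φ =
      complexState μ ζ φ * (((Real.exp (-μ φ) * (Real.cos (ζ φ) - n) / f : ℝ) : ℂ) +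
        Complex.I * ((-(Real.exp (-μ φ) * Real.sin (ζ φ)) / f + 1 : ℝ) : ℂ)) := by
  rw [norm_complexState]
  have hs : complexState μ ζ φ = Complex.exp (μ φ) *
      (Complex.cos (ζ φ) + Complex.sin (ζ φ) * Complex.I) := by
    rw [complexState, Complex.exp_add, mul_comm Complex.I, Complex.exp_mul_I]
  have h1 : Complex.exp (μ φ) ≠ 0 := Complex.exp_ne_zero _
  have h2 : (f : ℂ) ≠ 0 := by exact_mod_cast hf
  have h3 := Complex.sin_sq_add_cos_sq (ζ φ : ℂ)
  rw [hs]
  push_cast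
  rw [Complex.exp_neg]
  field_simp
  linear_combination (-1 : ℂ) * h3 + Complex.sin (ζ φ) ^ 2 * Complex.I_sq

theorem IsPursuitSolutionOn.isComplexPursuitSolutionOn (hb : 0 < b) (hab : b ≤ a)
    {μ ζ : ℝ → ℝ} {s : Set ℝ} (h : IsPursuitSolutionOn a b n μ ζ s) :
    IsComplexPursuitSolutionOn a b n (complexState μ ζ) s := by
  intro φ hφ
  refine ⟨complexState_ne_zero μ ζ φ, ?_⟩
  rw [complexField_eq (turningRate_pos hb hab φ).ne']
  have h1 := (h φ hφ).1.ofReal_comp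
  have h2 := ((h φ hφ).2.ofReal_comp).const_mul Complex.I
  exact (h1.add h2).cexp

theorem complexState_log {z : ℝ → ℂ} (hz : ∀ φ, z φ ≠ 0) :
    complexState (fun φ => (Complex.log (z φ)).re) (fun φ => (Complex.log (z φ)).im) = z := by
  funext φ
  rw [complexState, mul_comm Complex.I, Complex.re_add_im, Complex.exp_log (hz φ)]

/-- The upper half-plane avoids the branch cut, so the principal argument is differentiable and is
itself periodic, not merely modulo `2π`. -/
theorem isPeriodicPursuitSolution_log (hb : 0 < b) (hab : b ≤ a) {z : ℝ → ℂ}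
    (hz : IsPeriodicComplexPursuitSolution a b n z) (him : ∀ φ, 0 < (z φ).im) :
    IsPeriodicPursuitSolution a b n (fun φ => (Complex.log (z φ)).re)
      (fun φ => (Complex.log (z φ)).im) := by
  refine ⟨fun φ _ => ?_, fun φ => ?_, fun φ => ?_⟩
  · have hne : ∀ φ, z φ ≠ 0 := fun φ => (hz.1 φ (mem_univ φ)).1
    have h := (hz.1 φ (mem_univ φ)).2.hasDerivAt univ_mem
    have hcs := complexState_log hne
    have hfe := complexField_eq (n := n) (turningRate_pos hb hab φ).ne'
      (fun φ => (Complex.log (z φ)).re) (fun φ => (Complex.log (z φ)).im) φ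
    rw [hcs] at hfe
    rw [hfe] at h
    have hslit : z φ ∈ Complex.slitPlane := Or.inr (him φ).ne'
    have hl := h.clog_real hslit
    rw [mul_div_cancel_left₀ _ (hne φ)] at hl
    have hre := hasDerivAt_re hl
    have him' := hasDerivAt_im hl
    simp only [Complex.add_re, Complex.ofReal_re, Complex.I_mul_re, Complex.ofReal_im, neg_zero,
      add_zero] at hre
    simp only [Complex.add_im, Complex.ofReal_re, Complex.I_mul_im, Complex.ofReal_im,
      zero_add] at him'
    exact ⟨hre.hasDerivWithinAt, him'.hasDerivWithinAt⟩
  · simp only [hz.2 φ]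
  · simp only [hz.2 φ]

/-! ### Global convergence -/

/-- Every solution of the complex equation on a half-line converges to a solution that stays
uniformly inside the upper half-plane. -/
theorem tendsto_sub_of_isComplexPursuitSolutionOn (hb : 0 < b) (hab : b ≤ a) (hn0 : 0 < n)
    (hn1 : n < 1) {y₀ R φ₀ : ℝ} (hy₀ : 0 < y₀) {z w : ℝ → ℂ}
    (hz : IsComplexPursuitSolutionOn a b n z (Ici φ₀))
    (hw : IsComplexPursuitSolutionOn a b n w (Ici φ₀)) (hwb : ∀ φ, ‖w φ‖ ≤ R ∧ y₀ ≤ (w φ).im) :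
    Tendsto (fun φ => z φ - w φ) atTop (𝓝 0) := by
  -- The distance to `w` never grows, so this radius bounds `z` for all later times.
  obtain ⟨l, hl, h⟩ := exists_exponential_decay hb hab hn0 hn1 hy₀ (R + ‖z φ₀ - w φ₀‖)
  have hR : ∀ φ, φ₀ ≤ φ → ‖z φ‖ ≤ R + ‖z φ₀ - w φ₀‖ := by
    intro φ hφ
    have h1 := norm_sub_le_of_isComplexPursuitSolutionOn hb hab hn0 hz hw hφ
    have h2 := norm_le_norm_add_norm_sub' (z φ) (w φ)
    linarith [(hwb φ).1]
  have hdec := h z w φ₀ hz hw hR (fun φ _ => by linarith [(hwb φ).1, norm_nonneg (z φ₀ - w φ₀)])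
    (fun φ _ => (hwb φ).2)
  have hlim : Tendsto (fun φ => 3 * ‖z φ₀ - w φ₀‖ ^ 2 * Real.exp (-(l * (φ - φ₀)))) atTop (𝓝 0) := by
    have h1 : Tendsto (fun φ : ℝ => l * (φ - φ₀)) atTop atTop :=
      (tendsto_atTop_add_const_right _ (-φ₀) tendsto_id).const_mul_atTop hl
    have h2 := (Real.tendsto_exp_neg_atTop_nhds_zero.comp h1).const_mul (3 * ‖z φ₀ - w φ₀‖ ^ 2)
    rwa [mul_zero] at h2
  have hsq : Tendsto (fun φ => ‖z φ - w φ‖ ^ 2) atTop (𝓝 0) := by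
    refine tendsto_of_tendsto_of_tendsto_of_le_of_le' tendsto_const_nhds hlim
      (Eventually.of_forall fun φ => by positivity) ?_
    filter_upwards [eventually_ge_atTop φ₀] with φ hφ using hdec φ hφ
  rw [tendsto_zero_iff_norm_tendsto_zero]
  have := hsq.sqrt
  simpa [Real.sqrt_sq (norm_nonneg _)] using this

/-- Convergence of the complex states implies convergence of `μ` and of `ζ` modulo `2π`. -/
theorem tendsto_of_tendsto_complexState {μ ζ μ' ζ' : ℝ → ℝ} {y₀ φ₀ : ℝ} (hy₀ : 0 < y₀)
    (hμ : ContinuousOn μ (Ici φ₀)) (hζ : ContinuousOn ζ (Ici φ₀))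
    (hμ' : Continuous μ') (hζ' : Continuous ζ') (hlow : ∀ φ, y₀ ≤ ‖complexState μ' ζ' φ‖)
    (h : Tendsto (fun φ => complexState μ ζ φ - complexState μ' ζ' φ) atTop (𝓝 0)) :
    Tendsto (fun φ => μ φ - μ' φ) atTop (𝓝 0) ∧
      ∃ k : ℤ, Tendsto (fun φ => ζ φ - (ζ' φ + 2 * Real.pi * (k : ℝ))) atTop (𝓝 0) := by
  set m : ℝ → ℝ := fun φ => μ φ - μ' φ with hm
  set d : ℝ → ℝ := fun φ => ζ φ - ζ' φ with hd
  set E : ℝ → ℂ := fun φ => Complex.exp (m φ + Complex.I * d φ) with hE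
  have hEq : ∀ φ, E φ - 1 = (complexState μ ζ φ - complexState μ' ζ' φ) /
      complexState μ' ζ' φ := by
    intro φ
    rw [sub_div, div_self (complexState_ne_zero _ _ _), complexState, complexState,
      ← Complex.exp_sub]
    simp only [hE, hm, hd]
    push_cast
    ring_nf
  have hE1 : Tendsto E atTop (𝓝 1) := by
    rw [← tendsto_sub_nhds_zero_iff, tendsto_zero_iff_norm_tendsto_zero]
    have h1 : Tendsto (fun φ => ‖complexState μ ζ φ - complexState μ' ζ' φ‖ / y₀) atTop (𝓝 0) := by
      have := h.norm.div_const y₀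
      simpa using this
    refine squeeze_zero (fun _ => norm_nonneg _) (fun φ => ?_) h1
    rw [hEq, norm_div]
    have := hlow φ
    gcongr
  have h1s : (1 : ℂ) ∈ Complex.slitPlane := Complex.one_mem_slitPlane
  have hlog : Tendsto (fun φ => Complex.log (E φ)) atTop (𝓝 0) := by
    have := (continuousAt_clog h1s).tendsto.comp hE1
    rwa [Complex.log_one] at this
  have hnE : ∀ φ, ‖E φ‖ = Real.exp (m φ) := fun φ => by simp [hE, Complex.norm_exp]
  have hmre : ∀ φ, (Complex.log (E φ)).re = m φ := fun φ => by
    rw [Complex.log_re, hnE, Real.log_exp]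
  refine ⟨?_, ?_⟩
  · have := (Complex.continuous_re.tendsto 0).comp hlog
    exact this.congr hmre
  have harg : Tendsto (fun φ => (Complex.log (E φ)).im) atTop (𝓝 0) :=
    (Complex.continuous_im.tendsto 0).comp hlog
  obtain ⟨Φ, hΦ⟩ := eventually_atTop.1
    ((hE1.eventually (Complex.isOpen_slitPlane.mem_nhds h1s)).and (eventually_ge_atTop φ₀))
  have hint : ∀ φ, ∃ k : ℤ, d φ - (Complex.log (E φ)).im = k * (2 * Real.pi) := by
    intro φ
    have h2 : Complex.exp (Complex.log (E φ)) = Complex.exp (m φ + Complex.I * d φ) :=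
      Complex.exp_log (Complex.exp_ne_zero _)
    obtain ⟨k, hk⟩ := Complex.exp_eq_exp_iff_exists_int.1 h2
    refine ⟨-k, ?_⟩
    have h3 := congrArg Complex.im hk
    have h4 : ((k : ℂ) * (2 * Real.pi * Complex.I)).im = k * (2 * Real.pi) := by
      have : (k : ℂ) * (2 * Real.pi * Complex.I) = ((k * (2 * Real.pi) : ℝ) : ℂ) * Complex.I := by
        push_cast; ring
      rw [this]; simp
    rw [Complex.add_im, Complex.add_im, h4] at h3
    simp at h3
    push_cast
    linarith
  have hsub : Ici Φ ⊆ Ici φ₀ := fun φ hφ => (hΦ φ hφ).2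
  have hdc : ContinuousOn d (Ici Φ) := (hζ.mono hsub).sub hζ'.continuousOn
  have hmc : ContinuousOn m (Ici Φ) := (hμ.mono hsub).sub hμ'.continuousOn
  have hEc : ContinuousOn E (Ici Φ) :=
    Complex.continuous_exp.comp_continuousOn ((Complex.continuous_ofReal.comp_continuousOn hmc).add
      (continuousOn_const.mul (Complex.continuous_ofReal.comp_continuousOn hdc)))
  have hcont : ContinuousOn (fun φ => d φ - (Complex.log (E φ)).im) (Ici Φ) :=
    hdc.sub (Complex.continuous_im.comp_continuousOn (hEc.clog fun φ hφ => (hΦ φ hφ).1))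
  obtain ⟨k, hk⟩ := hint Φ
  -- Past `Φ` the quotient of the states avoids the branch cut, so this difference is continuous;
  -- with values in the discrete group `2πℤ` it is constant.
  have hconst : ∀ φ ∈ Ici Φ, d φ - (Complex.log (E φ)).im = k * (2 * Real.pi) := by
    intro φ hφ
    rw [← hk]
    refine isPreconnected_Ici.constant_of_mapsTo
      (T := (AddSubgroup.zmultiples (2 * Real.pi) : Set ℝ))
      (isDiscrete_iff_discreteTopology.2
        (inferInstanceAs (DiscreteTopology (AddSubgroup.zmultiples (2 * Real.pi))))) hcont (fun ψ _ => ?_) hφ self_mem_Ici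
    obtain ⟨j, hj⟩ := hint ψ
    exact AddSubgroup.mem_zmultiples_iff.2 ⟨j, (zsmul_eq_mul _ _).trans hj.symm⟩
  refine ⟨k, harg.congr' ?_⟩
  filter_upwards [eventually_ge_atTop Φ] with φ hφ
  have := hconst φ hφ
  simp only [hd] at this
  linarith

end

/-! ### Existence up to capture -/

theorem abs_exp_neg_sub_exp_neg_le {M s t : ℝ} (hs : -M ≤ s) (ht : -M ≤ t) :
    |Real.exp (-s) - Real.exp (-t)| ≤ Real.exp M * |s - t| := by
  have key : ∀ s t : ℝ, -M ≤ s → s ≤ t →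
      |Real.exp (-s) - Real.exp (-t)| ≤ Real.exp M * |s - t| := by
    intro s t hs hst
    have h1 : Real.exp (-t) = Real.exp (-s) * Real.exp (-(t - s)) := by
      rw [← Real.exp_add]; ring_nf
    have h2 : 1 - Real.exp (-(t - s)) ≤ t - s := by linarith [Real.add_one_le_exp (-(t - s))]
    have h3 : 0 ≤ 1 - Real.exp (-(t - s)) :=
      sub_nonneg.2 (Real.exp_le_one_iff.2 (by linarith))
    have h4 : Real.exp (-s) ≤ Real.exp M := Real.exp_le_exp.2 (by linarith)
    have h5 : Real.exp (-s) - Real.exp (-t) = Real.exp (-s) * (1 - Real.exp (-(t - s))) := by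
      rw [h1]; ring
    rw [h5, abs_of_nonneg (mul_nonneg (Real.exp_pos _).le h3), abs_sub_comm,
      abs_of_nonneg (sub_nonneg.2 hst)]
    exact mul_le_mul h4 h2 h3 (Real.exp_pos _).le
  rcases le_total s t with h | h
  · exact key s t hs h
  · rw [abs_sub_comm, abs_sub_comm s]
    exact key t s ht h

/-- The pursuit system with `e^(-μ)` truncated at `e^M`. -/
noncomputable def truncatedPolarField (a b n M φ : ℝ) (p : ℝ × ℝ) : ℝ × ℝ :=
  (Real.exp (-max p.1 (-M)) * (Real.cos p.2 - n) / turningRate a b φ,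
    -(Real.exp (-max p.1 (-M)) * Real.sin p.2) / turningRate a b φ + 1)

section
variable {a b n : ℝ}

theorem lipschitzWith_truncatedPolarField (hb : 0 < b) (hab : b ≤ a) (hn0 : 0 < n) (hn1 : n < 1)
    (M : ℝ) : ∃ K : NNReal, ∀ φ, LipschitzWith K (truncatedPolarField a b n M φ) := by
  have ha : 0 < a := by linarith
  refine ⟨(3 * Real.exp M * (a ^ 2 / b)).toNNReal, fun φ => LipschitzWith.of_dist_le_mul ?_⟩
  intro p q
  rw [Real.coe_toNNReal _ (by positivity)]
  have hg := turningRate_inv_le hb hab φ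
  have hg0 := inv_pos.2 (turningRate_pos hb hab φ)
  set g := (turningRate a b φ)⁻¹
  obtain ⟨G, hG⟩ : ∃ G, G = Real.exp (-max p.1 (-M)) := ⟨_, rfl⟩
  obtain ⟨H, hH⟩ : ∃ H, H = Real.exp (-max q.1 (-M)) := ⟨_, rfl⟩
  have hd1 : |p.1 - q.1| ≤ dist p q := le_max_left _ _
  have hd2 : |p.2 - q.2| ≤ dist p q := le_max_right _ _
  have hGH : |G - H| ≤ Real.exp M * dist p q := by
    rw [hG, hH]
    refine (abs_exp_neg_sub_exp_neg_le (le_max_right _ _) (le_max_right _ _)).trans ?_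
    gcongr
    exact (abs_max_sub_max_le_abs _ _ _).trans hd1
  have hH1 : |H| ≤ Real.exp M := by
    rw [hH, abs_of_pos (Real.exp_pos _), Real.exp_le_exp]
    linarith [le_max_right q.1 (-M)]
  have hcos : |Real.cos p.2 - Real.cos q.2| ≤ dist p q :=
    (Real.abs_cos_sub_cos_le _ _).trans hd2
  have hsin : |Real.sin p.2 - Real.sin q.2| ≤ dist p q :=
    (Real.abs_sin_sub_sin_le _ _).trans hd2
  have hcn : |Real.cos p.2 - n| ≤ 2 := by
    rw [abs_le]; constructor <;> linarith [Real.neg_one_le_cos p.2, Real.cos_le_one p.2]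
  have e1 : (truncatedPolarField a b n M φ p).1 - (truncatedPolarField a b n M φ q).1 =
      ((G - H) * (Real.cos p.2 - n) + H * (Real.cos p.2 - Real.cos q.2)) * g := by
    simp only [truncatedPolarField, ← hG, ← hH, g]
    ring
  have e2 : (truncatedPolarField a b n M φ p).2 - (truncatedPolarField a b n M φ q).2 =
      -((G - H) * Real.sin p.2 + H * (Real.sin p.2 - Real.sin q.2)) * g := by
    simp only [truncatedPolarField, ← hG, ← hH, g]
    ring
  apply max_le
  · rw [Real.dist_eq, e1, abs_mul, abs_of_pos hg0]
    calc _ ≤ (Real.exp M * dist p q * 2 + Real.exp M * dist p q) * (a ^ 2 / b) := by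
          gcongr
          refine (abs_add_le _ _).trans ?_
          rw [abs_mul, abs_mul]
          gcongr
      _ = _ := by ring
  · rw [Real.dist_eq, e2, abs_mul, abs_neg, abs_of_pos hg0]
    have hs1 : |Real.sin p.2| ≤ 2 := (Real.abs_sin_le_one _).trans one_le_two
    calc _ ≤ (Real.exp M * dist p q * 2 + Real.exp M * dist p q) * (a ^ 2 / b) := by
          gcongr
          refine (abs_add_le _ _).trans ?_
          rw [abs_mul, abs_mul]
          gcongr
      _ = _ := by ring

theorem exists_truncatedPolarSolution (hb : 0 < b) (hab : b ≤ a) (hn0 : 0 < n) (hn1 : n < 1)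
    (M φ₀ : ℝ) (p₀ : ℝ × ℝ) : ∃ p : ℝ → ℝ × ℝ, p φ₀ = p₀ ∧
      ∀ φ, HasDerivAt p (truncatedPolarField a b n M φ (p φ)) φ := by
  have ha : 0 < a := by linarith
  obtain ⟨K, hK⟩ := lipschitzWith_truncatedPolarField hb hab hn0 hn1 M
  have hgc := continuous_turningRate_inv hb hab
  refine exists_global_solution (L := (2 * Real.exp M * (a ^ 2 / b) + 1).toNNReal) hK ?_ ?_ φ₀ p₀
  · intro p
    simp only [truncatedPolarField, div_eq_mul_inv]
    fun_prop
  · intro φ p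
    rw [Real.coe_toNNReal _ (by positivity)]
    have hg := turningRate_inv_le hb hab φ
    have hg0 := inv_pos.2 (turningRate_pos hb hab φ)
    have hG : |Real.exp (-max p.1 (-M))| ≤ Real.exp M := by
      rw [abs_of_pos (Real.exp_pos _), Real.exp_le_exp]
      linarith [le_max_right p.1 (-M)]
    have hcn : |Real.cos p.2 - n| ≤ 2 := by
      rw [abs_le]; constructor <;> linarith [Real.neg_one_le_cos p.2, Real.cos_le_one p.2]
    have hs1 : |Real.sin p.2| ≤ 2 := (Real.abs_sin_le_one _).trans one_le_two
    apply max_le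
    · rw [Real.norm_eq_abs, truncatedPolarField, div_eq_mul_inv, abs_mul, abs_mul, abs_of_pos hg0]
      calc _ ≤ Real.exp M * 2 * (a ^ 2 / b) := by gcongr
        _ ≤ _ := by linarith
    · rw [Real.norm_eq_abs, truncatedPolarField]
      refine (abs_add_le _ _).trans ?_
      rw [div_eq_mul_inv, abs_mul, abs_neg, abs_mul, abs_of_pos hg0, abs_one]
      calc _ ≤ Real.exp M * 2 * (a ^ 2 / b) + 1 := by gcongr
        _ ≤ _ := by linarith

/-- A solution of the pursuit system with `μ ≥ -M` solves the truncated system. -/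
theorem IsPursuitSolutionOn.eqOn_truncatedPolarSolution (hb : 0 < b) (hab : b ≤ a) (hn0 : 0 < n)
    (hn1 : n < 1) {M φ₀ T : ℝ} {μ ζ : ℝ → ℝ} (h : IsPursuitSolutionOn a b n μ ζ (Icc φ₀ T))
    (hM : ∀ φ ∈ Icc φ₀ T, -M ≤ μ φ) {p : ℝ → ℝ × ℝ}
    (hp : ∀ φ, HasDerivAt p (truncatedPolarField a b n M φ (p φ)) φ)
    (h0 : p φ₀ = (μ φ₀, ζ φ₀)) : EqOn p (fun φ => (μ φ, ζ φ)) (Icc φ₀ T) := by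
  obtain ⟨K, hK⟩ := lipschitzWith_truncatedPolarField hb hab hn0 hn1 M
  refine ODE_solution_unique hK (fun t _ => (hp t).continuousAt.continuousWithinAt)
    (fun t _ => (hp t).hasDerivWithinAt)
    (fun t ht => ((h t ht).1.prodMk (h t ht).2).continuousWithinAt) (fun t ht => ?_) h0
  have ht' := Ico_subset_Icc_self ht
  have hmax : max (μ t) (-M) = μ t := max_eq_left (hM t ht')
  have := ((h t ht').1.prodMk (h t ht').2).mono_of_mem_nhdsWithin (Icc_mem_nhdsGE_of_mem ht)
  simpa only [truncatedPolarField, hmax] using this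

/-- The converse: where `μ ≥ -M`, a truncated solution solves the pursuit system. -/
theorem isPursuitSolutionOn_of_truncatedPolarSolution {M : ℝ} {p : ℝ → ℝ × ℝ}
    (hp : ∀ φ, HasDerivAt p (truncatedPolarField a b n M φ (p φ)) φ) {s : Set ℝ}
    (hs : ∀ φ ∈ s, -M ≤ (p φ).1) :
    IsPursuitSolutionOn a b n (fun φ => (p φ).1) (fun φ => (p φ).2) s := by
  intro φ hφ
  have h1 : HasDerivAt (fun φ => (p φ).1) _ φ :=
    (ContinuousLinearMap.fst ℝ ℝ ℝ).hasFDerivAt.comp_hasDerivAt φ (hp φ)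
  have h2 : HasDerivAt (fun φ => (p φ).2) _ φ :=
    (ContinuousLinearMap.snd ℝ ℝ ℝ).hasFDerivAt.comp_hasDerivAt φ (hp φ)
  have hmax : max (p φ).1 (-M) = (p φ).1 := max_eq_left (hs φ hφ)
  simp only [truncatedPolarField, hmax, ContinuousLinearMap.coe_fst',
    ContinuousLinearMap.coe_snd'] at h1 h2
  exact ⟨h1.hasDerivWithinAt, h2.hasDerivWithinAt⟩

/-- If `μ` is not bounded below on `[φ₀, φB)`, then it tends to `-∞` at `φB`. -/
theorem IsPursuitSolutionOn.tendsto_atBot (hb : 0 < b) (hab : b ≤ a) (hn0 : 0 < n)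
    (hn1 : n < 1) {φ₀ φB : ℝ} (hφ : φ₀ < φB) {μ ζ : ℝ → ℝ}
    (h : IsPursuitSolutionOn a b n μ ζ (Ico φ₀ φB)) (hun : ∀ M, ∃ φ ∈ Ico φ₀ φB, μ φ < M) :
    Tendsto μ (𝓝[<] φB) atBot := by
  have ha : 0 < a := by linarith
  obtain ⟨L, hL⟩ : ∃ L, L = 2 * (a ^ 2 / b) := ⟨_, rfl⟩
  have hLp : 0 < L := by rw [hL]; positivity
  -- Although `μ'` may blow up, `(e^μ)' = (cos ζ - n) / f` is bounded; so if `e^μ` is small at one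
  -- time close to `φB`, it is small throughout a neighbourhood of the end.
  have hlip : ∀ s ∈ Ico φ₀ φB, ∀ t ∈ Ico φ₀ φB,
      ‖Real.exp (μ t) - Real.exp (μ s)‖ ≤ L * ‖t - s‖ := by
    intro s hs t ht
    refine (convex_Ico φ₀ φB).norm_image_sub_le_of_norm_hasDerivWithin_le
      (f := fun t => Real.exp (μ t)) (fun t ht => (h t ht).1.exp) (fun t _ => ?_) hs ht
    have hg := turningRate_inv_le hb hab t
    have hg0 := inv_pos.2 (turningRate_pos hb hab t)
    have hcn : |Real.cos (ζ t) - n| ≤ 2 := by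
      rw [abs_le]; constructor <;> linarith [Real.neg_one_le_cos (ζ t), Real.cos_le_one (ζ t)]
    have h1 : Real.exp (μ t) * (Real.exp (-μ t) * (Real.cos (ζ t) - n) / turningRate a b t) =
        (Real.cos (ζ t) - n) * (turningRate a b t)⁻¹ := by
      rw [Real.exp_neg]; field_simp
    rw [h1, Real.norm_eq_abs, abs_mul, abs_of_pos hg0, hL]
    gcongr
  rw [Filter.tendsto_atBot]
  intro N
  obtain ⟨ρ, hρ⟩ : ∃ ρ, ρ = Real.exp N := ⟨_, rfl⟩
  have hρp : 0 < ρ := hρ ▸ Real.exp_pos N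
  obtain ⟨c, hc⟩ : ∃ c, c = max φ₀ (φB - ρ / (2 * L)) := ⟨_, rfl⟩
  have hcB : c < φB := by
    rw [hc]; exact max_lt hφ (by linarith [show 0 < ρ / (2 * L) by positivity])
  have hc0 : φ₀ ≤ c := hc ▸ le_max_left _ _
  have hc1 : φB - c ≤ ρ / (2 * L) := by
    have : φB - ρ / (2 * L) ≤ c := hc ▸ le_max_right _ _
    linarith
  have hcont : ContinuousOn μ (Icc φ₀ c) := fun t ht =>
    ((h t ⟨ht.1, ht.2.trans_lt hcB⟩).1.continuousWithinAt).mono fun s hs =>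
      ⟨hs.1, hs.2.trans_lt hcB⟩
  obtain ⟨m, hm⟩ := (isCompact_Icc.image_of_continuousOn hcont).bddBelow
  -- A value below the minimum on `[φ₀, c]` forces `ψ > c`.
  obtain ⟨ψ, hψ, hψm⟩ := hun (min m (Real.log (ρ / 2)))
  have hcψ : c < ψ := by
    by_contra! hle
    exact absurd (hm (mem_image_of_mem μ ⟨hψ.1, hle⟩)) (not_le.2 (hψm.trans_le (min_le_left _ _)))
  have hψρ : Real.exp (μ ψ) ≤ ρ / 2 := by
    rw [← Real.exp_log (by positivity : 0 < ρ / 2), Real.exp_le_exp]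
    exact (hψm.trans_le (min_le_right _ _)).le
  filter_upwards [Ioo_mem_nhdsLT hcB] with t ht
  have h1 := hlip ψ hψ t ⟨hc0.trans ht.1.le, ht.2⟩
  have h2 : |t - ψ| ≤ ρ / (2 * L) := by
    rw [abs_le]; constructor <;> linarith [ht.1, ht.2, hψ.2]
  have h3 : L * |t - ψ| ≤ ρ / 2 := by
    calc _ ≤ L * (ρ / (2 * L)) := by gcongr
      _ = ρ / 2 := by field_simp
  rw [Real.norm_eq_abs, Real.norm_eq_abs] at h1
  have h4 := (le_abs_self _).trans (h1.trans h3)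
  rw [← Real.exp_le_exp, ← hρ]
  linarith

/-- Solutions exist until capture. -/
theorem exists_global_or_capture (hb : 0 < b) (hab : b ≤ a) (hn0 : 0 < n) (hn1 : n < 1)
    (φ₀ μ₀ ζ₀ : ℝ) :
    (∃ μ ζ : ℝ → ℝ, IsPursuitSolutionOn a b n μ ζ (Ici φ₀) ∧ μ φ₀ = μ₀ ∧ ζ φ₀ = ζ₀) ∨
    (∃ φB : ℝ, φ₀ < φB ∧ ∃ μ ζ : ℝ → ℝ,
      IsPursuitSolutionOn a b n μ ζ (Ico φ₀ φB) ∧ μ φ₀ = μ₀ ∧ ζ φ₀ = ζ₀ ∧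
      Tendsto μ (𝓝[<] φB) atBot) := by
  choose p hp0 hp using fun j : ℕ =>
    exists_truncatedPolarSolution hb hab hn0 hn1 (j : ℝ) φ₀ (μ₀, ζ₀)
  have hcont : ∀ j, Continuous fun φ => (p j φ).1 := fun j =>
    continuous_fst.comp (continuous_iff_continuousAt.2 fun φ => (hp j φ).continuousAt)
  -- The strict inequality makes the condition persist a little to the right. While it holds, the
  -- `j`-th truncation is inactive and all such truncated solutions agree.
  let good : ℕ → ℝ → Prop := fun j φ => ∀ ψ ∈ Icc φ₀ φ, -(j : ℝ) < (p j ψ).1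
  have hmono : ∀ i j φ, i ≤ j → good i φ → EqOn (p j) (p i) (Icc φ₀ φ) := by
    intro i j φ hij hi
    have hij' : (i : ℝ) ≤ j := by exact_mod_cast hij
    have h1 := isPursuitSolutionOn_of_truncatedPolarSolution (hp i) (s := Icc φ₀ φ)
      fun ψ hψ => (hi ψ hψ).le
    exact h1.eqOn_truncatedPolarSolution hb hab hn0 hn1
      (fun ψ hψ => by linarith [hi ψ hψ]) (hp j) (by rw [hp0 j, hp0 i])
  have hagree : ∀ i j φ, good i φ → good j φ → EqOn (p i) (p j) (Icc φ₀ φ) := by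
    intro i j φ hi hj
    rcases le_total i j with h | h
    · exact (hmono i j φ h hi).symm
    · exact hmono j i φ h hj
  have hdown : ∀ j φ ψ, ψ ≤ φ → good j φ → good j ψ := fun j φ ψ h hg t ht =>
    hg t ⟨ht.1, ht.2.trans h⟩
  have hright : ∀ j φ, φ₀ ≤ φ → good j φ → ∃ φ', φ < φ' ∧ good j φ' := by
    intro j φ hφ hg
    have h1 : ∀ᶠ ψ in 𝓝 φ, -(j : ℝ) < (p j ψ).1 :=
      (hcont j).continuousAt.eventually (lt_mem_nhds (hg φ ⟨hφ, le_rfl⟩))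
    obtain ⟨r, hr, hball⟩ := Metric.eventually_nhds_iff.1 h1
    refine ⟨φ + r / 2, by linarith, fun ψ hψ => ?_⟩
    rcases le_or_gt ψ φ with h | h
    · exact hg ψ ⟨hψ.1, h⟩
    · apply hball
      rw [Real.dist_eq, abs_of_pos (sub_pos.2 h)]
      linarith [hψ.2]
  obtain ⟨j₀, hj₀⟩ := exists_nat_gt (-μ₀)
  have hstart : good j₀ φ₀ := by
    intro ψ hψ
    have : ψ = φ₀ := le_antisymm hψ.2 hψ.1
    rw [this, hp0]
    simp only
    linarith
  let S : Set ℝ := {φ | φ₀ ≤ φ ∧ ∃ j, good j φ}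
  choose! J hJ using fun φ (hφ : φ ∈ S) => hφ.2
  let X : ℝ → ℝ × ℝ := fun φ => p (J φ) φ
  have hX : ∀ j φ, φ₀ ≤ φ → good j φ → EqOn X (p j) (Icc φ₀ φ) := by
    intro j φ _ hg ψ hψ
    have hgψ := hdown j φ ψ hψ.2 hg
    exact hagree (J ψ) j ψ (hJ ψ ⟨hψ.1, j, hgψ⟩) hgψ ⟨hψ.1, le_rfl⟩
  have hX0 : X φ₀ = (μ₀, ζ₀) := by
    rw [hX j₀ φ₀ le_rfl hstart ⟨le_rfl, le_rfl⟩, hp0]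
  have hsol : IsPursuitSolutionOn a b n (fun φ => (X φ).1) (fun φ => (X φ).2) S := by
    intro φ hφ
    obtain ⟨h0, j, hg⟩ := hφ
    obtain ⟨φ', hφ', hg'⟩ := hright j φ h0 hg
    have h1 := isPursuitSolutionOn_of_truncatedPolarSolution (hp j) (s := {ψ | -(j : ℝ) ≤ (p j ψ).1})
      fun ψ hψ => hψ
    have h2 := isPursuitSolutionOn_of_truncatedPolarSolution (hp j) (s := Icc φ₀ φ')
      (fun ψ hψ => (hg' ψ hψ).le) φ ⟨h0, hφ'.le⟩
    have hXφ : X φ = p j φ := hX j φ' (h0.trans hφ'.le) hg' ⟨h0, hφ'.le⟩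
    have hmem : Icc φ₀ φ' ∈ 𝓝[S] φ := by
      refine mem_of_superset (inter_mem_nhdsWithin S (Iio_mem_nhds hφ')) ?_
      exact fun ψ hψ => ⟨hψ.1.1, hψ.2.le⟩
    have hev : ∀ᶠ ψ in 𝓝[S] φ, X ψ = p j ψ :=
      mem_of_superset hmem (hX j φ' (h0.trans hφ'.le) hg')
    have k1 := (h2.1.mono_of_mem_nhdsWithin hmem).congr_of_eventuallyEq
      (f₁ := fun φ => (X φ).1) (hev.mono fun ψ hψ => by simp only [hψ]) (by simp only [hXφ])
    have k2 := (h2.2.mono_of_mem_nhdsWithin hmem).congr_of_eventuallyEq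
      (f₁ := fun φ => (X φ).2) (hev.mono fun ψ hψ => by simp only [hψ]) (by simp only [hXφ])
    simp only [hXφ]
    exact ⟨k1, k2⟩
  by_cases hall : Ici φ₀ ⊆ S
  · exact Or.inl ⟨_, _, hsol.mono hall, by rw [hX0], by rw [hX0]⟩
  right
  obtain ⟨ψ, hψ0, hψS⟩ := not_subset.1 hall
  let C : Set ℝ := {φ | φ₀ ≤ φ ∧ φ ∉ S}
  have hCne : C.Nonempty := ⟨ψ, hψ0, hψS⟩
  have hCb : BddBelow C := ⟨φ₀, fun φ hφ => hφ.1⟩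
  have hB0 : φ₀ ≤ sInf C := le_csInf hCne fun φ hφ => hφ.1
  have hBS : sInf C ∉ S := by
    rintro ⟨_, j, hg⟩
    obtain ⟨φ', hφ', hg'⟩ := hright j _ hB0 hg
    refine absurd (le_csInf hCne fun φ hφ => ?_) (not_le.2 hφ')
    by_contra! hlt
    exact hφ.2 ⟨hφ.1, j, hdown j φ' φ hlt.le hg'⟩
  have hBpos : φ₀ < sInf C := by
    refine lt_of_le_of_ne hB0 fun h => hBS ?_
    rw [← h]
    exact ⟨le_rfl, j₀, hstart⟩
  have hsub : Ico φ₀ (sInf C) ⊆ S := by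
    intro φ hφ
    by_contra hnot
    exact absurd (csInf_le hCb ⟨hφ.1, hnot⟩) (not_le.2 hφ.2)
  have hsolB := hsol.mono hsub
  refine ⟨sInf C, hBpos, _, _, hsolB, by rw [hX0], by rw [hX0],
    hsolB.tendsto_atBot hb hab hn0 hn1 hBpos fun M => ?_⟩
  -- If `μ` were bounded below by `M`, the truncated solution with `j > -M` would follow it up to
  -- `sInf C` and, by continuity, stay above `-j` there, putting `sInf C` into `S`.
  by_contra! hlow
  obtain ⟨j, hj⟩ := exists_nat_gt (-M)
  have heq : ∀ φ ∈ Ico φ₀ (sInf C), p j φ = X φ := by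
    intro φ hφ
    have hI : Icc φ₀ φ ⊆ Ico φ₀ (sInf C) := fun t ht => ⟨ht.1, ht.2.trans_lt hφ.2⟩
    exact (hsolB.mono hI).eqOn_truncatedPolarSolution hb hab hn0 hn1
      (fun t ht => by linarith [hlow t (hI ht)]) (hp j) (by rw [hp0, ← hX0]) ⟨hφ.1, le_rfl⟩
  have hMj : ∀ φ ∈ Ico φ₀ (sInf C), M ≤ (p j φ).1 := fun φ hφ => by
    rw [heq φ hφ]; exact hlow φ hφ
  have hMB : M ≤ (p j (sInf C)).1 := by
    have h1 : Tendsto (fun φ => (p j φ).1) (𝓝[<] (sInf C)) (𝓝 (p j (sInf C)).1) :=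
      (hcont j).continuousAt.continuousWithinAt
    refine ge_of_tendsto h1 ?_
    filter_upwards [Ico_mem_nhdsLT hBpos] with φ hφ using hMj φ hφ
  refine hBS ⟨hB0, j, fun t ht => ?_⟩
  rcases ht.2.eq_or_lt with h | h
  · rw [h]; linarith
  · linarith [hMj t ⟨ht.1, h⟩]

end

/-! ### The main theorem -/

theorem mainTheorem1 (a b n : ℝ) (hb : 0 < b) (hab : b ≤ a) (hn0 : 0 < n) (hn1 : n < 1) :
    ∃ μs ζs : ℝ → ℝ,
      -- existence and uniqueness (up to integer multiples of `2π` in `ζ`)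
      IsPeriodicPursuitSolution a b n μs ζs ∧
      (∀ μ ζ : ℝ → ℝ, IsPeriodicPursuitSolution a b n μ ζ →
        μ = μs ∧ ∃ k : ℤ, ∀ φ : ℝ, ζ φ = ζs φ + 2 * Real.pi * (k : ℝ)) ∧
      -- every solution on a half-line converges to it
      (∀ (φ₀ : ℝ) (μ ζ : ℝ → ℝ), IsPursuitSolutionOn a b n μ ζ (Set.Ici φ₀) →
        Filter.Tendsto (fun φ => μ φ - μs φ) Filter.atTop (nhds 0) ∧
        ∃ k : ℤ, Filter.Tendsto (fun φ => ζ φ - (ζs φ + 2 * Real.pi * (k : ℝ)))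
          Filter.atTop (nhds 0)) ∧
      -- a solution that does not reach `φ = ∞` ends by capture, `μ → -∞`
      (∀ φ₀ μ₀ ζ₀ : ℝ,
        (∃ μ ζ : ℝ → ℝ, IsPursuitSolutionOn a b n μ ζ (Set.Ici φ₀) ∧ μ φ₀ = μ₀ ∧ ζ φ₀ = ζ₀) ∨
        (∃ φB : ℝ, φ₀ < φB ∧ ∃ μ ζ : ℝ → ℝ,
          IsPursuitSolutionOn a b n μ ζ (Set.Ico φ₀ φB) ∧ μ φ₀ = μ₀ ∧ ζ φ₀ = ζ₀ ∧
          Filter.Tendsto μ (nhdsWithin φB (Set.Iio φB)) Filter.atBot)) ∧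
      -- the same for the complex equation
      IsPeriodicComplexPursuitSolution a b n (complexState μs ζs) ∧
      (∀ z : ℝ → ℂ, IsPeriodicComplexPursuitSolution a b n z → z = complexState μs ζs) ∧
      (∀ (φ₀ : ℝ) (z : ℝ → ℂ), IsComplexPursuitSolutionOn a b n z (Set.Ici φ₀) →
        Filter.Tendsto (fun φ => z φ - complexState μs ζs φ) Filter.atTop (nhds 0)) := by
  obtain ⟨y₀, hy₀, R, w, hw, hwb⟩ := exists_isPeriodicComplexPursuitSolution hb hab hn0 hn1
  obtain ⟨μs, hμs⟩ : ∃ μs : ℝ → ℝ, μs = fun φ => (Complex.log (w φ)).re := ⟨_, rfl⟩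
  obtain ⟨ζs, hζs⟩ : ∃ ζs : ℝ → ℝ, ζs = fun φ => (Complex.log (w φ)).im := ⟨_, rfl⟩
  have hcs : complexState μs ζs = w := by
    rw [hμs, hζs]; exact complexState_log fun φ => (hw.1 φ (mem_univ φ)).1
  have hper : IsPeriodicPursuitSolution a b n μs ζs := by
    rw [hμs, hζs]
    exact isPeriodicPursuitSolution_log hb hab hw fun φ => hy₀.trans_le (hwb φ).2
  have hμc : Continuous μs := continuous_iff_continuousAt.2 fun φ =>
    ((hper.1 φ (mem_univ φ)).1.hasDerivAt univ_mem).continuousAt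
  have hζc : Continuous ζs := continuous_iff_continuousAt.2 fun φ =>
    ((hper.1 φ (mem_univ φ)).2.hasDerivAt univ_mem).continuousAt
  have hconv : ∀ (φ₀ : ℝ) (z : ℝ → ℂ), IsComplexPursuitSolutionOn a b n z (Ici φ₀) →
      Tendsto (fun φ => z φ - w φ) atTop (𝓝 0) := fun φ₀ z hz =>
    tendsto_sub_of_isComplexPursuitSolutionOn hb hab hn0 hn1 hy₀ hz
      (hw.1.mono (subset_univ _)) hwb
  have hconv' : ∀ (φ₀ : ℝ) (μ ζ : ℝ → ℝ), IsPursuitSolutionOn a b n μ ζ (Ici φ₀) →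
      Tendsto (fun φ => μ φ - μs φ) atTop (𝓝 0) ∧
      ∃ k : ℤ, Tendsto (fun φ => ζ φ - (ζs φ + 2 * Real.pi * (k : ℝ))) atTop (𝓝 0) := by
    intro φ₀ μ ζ h
    refine tendsto_of_tendsto_complexState hy₀ (fun φ hφ => (h φ hφ).1.continuousWithinAt)
      (fun φ hφ => (h φ hφ).2.continuousWithinAt) hμc hζc (fun φ => ?_) ?_
    · rw [hcs]
      exact (hwb φ).2.trans ((le_abs_self _).trans (Complex.abs_im_le_norm _))
    · rw [hcs]
      exact hconv φ₀ _ (h.isComplexPursuitSolutionOn hb hab)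
  refine ⟨μs, ζs, hper, ?_, hconv', exists_global_or_capture hb hab hn0 hn1, ?_, ?_, ?_⟩
  · intro μ ζ h
    obtain ⟨h1, k, h2⟩ := hconv' 0 μ ζ (h.1.mono (subset_univ _))
    refine ⟨funext fun φ => ?_, k, fun φ => ?_⟩
    · exact sub_eq_zero.1 (Function.Periodic.eq_zero_of_tendsto Real.pi_pos
        (f := fun φ => μ φ - μs φ) (fun φ => by simp only [h.2.1 φ, hper.2.1 φ]) h1 φ)
    · exact sub_eq_zero.1 (Function.Periodic.eq_zero_of_tendsto Real.pi_pos
        (f := fun φ => ζ φ - (ζs φ + 2 * Real.pi * (k : ℝ)))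
        (fun φ => by simp only [h.2.2 φ, hper.2.2 φ]) h2 φ)
  · rwa [hcs]
  · intro z hz
    rw [hcs]
    funext φ
    exact sub_eq_zero.1 (Function.Periodic.eq_zero_of_tendsto Real.pi_pos
      (f := fun φ => z φ - w φ) (fun φ => by simp only [hz.2 φ, hw.2 φ])
      (hconv 0 z (hz.1.mono (subset_univ _))) φ)
  · rw [hcs]
    exact hconv
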